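/- Let $d\ge 1$ be an integer, let $R$ be a commutative artinian ring and let $\Lambda$ be an Artin $R$-algebra (an $R$-algebra that is finitely generated as an $R$-module). Let $\operatorname{mod}\Lambda$ be the category of finitely generated right $\Lambda$-modules. Let $I$ be an injective envelope of $S_1\oplus\cdots\oplus S_n$, where $S_1,\dots,S_n$ is a complete set of representatives of the isomorphism classes of simple $R$-modules, and let $D=\operatorname{Hom}_R(-,I)$, a duality between finitely generated right and left $\Lambda$-modules. A full subcategory $\mathcal M\subseteq\operatorname{mod}\Lambda$ is \emph{$d$-cluster-tilting} if it is functorially finite in $\operatorname{mod}\Lambda$ and $$\mathcal M=\{X\in\operatorname{mod}\Lambda : \operatorname{Ext}^k_\Lambda(X,Y)=0\ \text{for all } Y\in\mathcal M,\ 1\le k\le d-1\}=\{Y\in\operatorname{mod}\Lambda : \operatorname{Ext}^k_\Lambda(X,Y)=0\ \text{for all } X\in\mathcal M,\ 1\le k\le d-1\}.$$ A complex $L\to M^1\to\cdots\to M^d\to N$ in $\mathcal M$ is a \emph{left $d$-exact sequence in $\mathcal M$} if for every $X\in\mathcal M$ the induced sequence $$0\to\operatorname{Hom}_\Lambda(X,L)\to\operatorname{Hom}_\Lambda(X,M^1)\to\cdots\to\operatorname{Hom}_\Lambda(X,M^d)\to\operatorname{Hom}_\Lambda(X,N)$$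 is exact. An object $X\in\mathcal M$ is a \emph{right determiner in $\mathcal M$} of a morphism $g\colon M\to N$ in $\mathcal M$ if every morphism $h\colon V\to N$ in $\mathcal M$ with $\operatorname{Im}\operatorname{Hom}_\Lambda(X,h)\subseteq\operatorname{Im}\operatorname{Hom}_\Lambda(X,g)$ factors through $g$. For $L\in\operatorname{mod}\Lambda$ put $\tau_d^-L=\operatorname{Tr}_d DL=\operatorname{Tr}\Omega^{d-1}DL$; explicitly, if $\cdots\to P_1\to P_0\to DL\to 0$ is a resolution by finitely generated projective left $\Lambda$-modules, then $\tau_d^-L$ is the right $\Lambda$-module $\operatorname{Coker}\bigl(\operatorname{Hom}_\Lambda(P_{d-1},\Lambda)\to\operatorname{Hom}_\Lambda(P_d,\Lambda)\bigr)$, which is determined up to projective direct summands; the statement below holds for every choice of the resolution (in particular for the minimal one). \textbf{Theorem.} Let $\mathcal M$ be a $d$-cluster-tilting subcategory of $\operatorname{mod}\Lambda$ and $$0\to L\to M^1\to\cdots\to M^d\xrightarrow{\,g\,}N$$ a left $d$-exact sequence in $\mathcal M$. Then $\Lambda\oplus\tau_d^-L$ lies in $\mathcal M$ and is a right determiner of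 $g$ in $\mathcal M$. If $g$ is an epimorphism, then $\tau_d^-L$ lies in $\mathcal M$ and is a right determiner of $g$ in $\mathcal M$. -/

import Mathlib

open CategoryTheory

universe u

namespace HigherAR

/-! ### Subcategories of the category of finitely generated right modules

Right `Λ`-modules are modules over `Λᵐᵒᵖ`.  A full subcategory is given by a predicate
`M : ObjectProperty (ModuleCat Λᵐᵒᵖ)` on its objects. -/

section Subcategories

variable {Λ : Type u} [Ring Λ]

/-- The category `mod Λ` of finitely generated right `Λ`-modules (over an Artin algebra these are
the modules of finite length, and also the finitely presented ones). -/
def fgMod (Λ : Type u) [Ring Λ] : ObjectProperty (ModuleCat.{u} Λᵐᵒᵖ) :=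
  fun X => Module.Finite Λᵐᵒᵖ X

/-- Every finitely generated module has a right `M`-approximation. -/
def IsContravariantlyFinite (M : ObjectProperty (ModuleCat.{u} Λᵐᵒᵖ)) : Prop :=
  ∀ Y : ModuleCat.{u} Λᵐᵒᵖ, fgMod Λ Y → ∃ (A : ModuleCat.{u} Λᵐᵒᵖ) (f : A ⟶ Y), M A ∧
    ∀ B : ModuleCat.{u} Λᵐᵒᵖ, M B → ∀ b : B ⟶ Y, ∃ a : B ⟶ A, a ≫ f = b

/-- Every finitely generated module has a left `M`-approximation. -/
def IsCovariantlyFinite (M : ObjectProperty (ModuleCat.{u} Λᵐᵒᵖ)) : Prop :=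
  ∀ Y : ModuleCat.{u} Λᵐᵒᵖ, fgMod Λ Y → ∃ (A : ModuleCat.{u} Λᵐᵒᵖ) (f : Y ⟶ A), M A ∧
    ∀ B : ModuleCat.{u} Λᵐᵒᵖ, M B → ∀ b : Y ⟶ B, ∃ a : A ⟶ B, f ≫ a = b

/-- `M` is a `d`-cluster-tilting subcategory of `mod Λ`.  The last two conditions force `M` to
consist of finitely generated modules and to be closed under isomorphisms, finite direct sums and
direct summands. -/
structure IsClusterTilting (d : ℕ) (M : ObjectProperty (ModuleCat.{u} Λᵐᵒᵖ)) : Prop where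
  contravariantlyFinite : IsContravariantlyFinite M
  covariantlyFinite : IsCovariantlyFinite M
  mem_iff_left : ∀ X : ModuleCat.{u} Λᵐᵒᵖ, M X ↔ fgMod Λ X ∧
    ∀ Y : ModuleCat.{u} Λᵐᵒᵖ, M Y → ∀ k : ℕ, 1 ≤ k → k ≤ d - 1 → Subsingleton (Abelian.Ext X Y k)
  mem_iff_right : ∀ Y : ModuleCat.{u} Λᵐᵒᵖ, M Y ↔ fgMod Λ Y ∧
    ∀ X : ModuleCat.{u} Λᵐᵒᵖ, M X → ∀ k : ℕ, 1 ≤ k → k ≤ d - 1 → Subsingleton (Abelian.Ext X Y k)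

/-- A complex `L = S₀ ⟶ S₁ ⟶ ⋯ ⟶ S_d ⟶ S_{d+1} = N` in `M` is a left `d`-exact sequence in `M` if
`0 ⟶ Hom(X, S₀) ⟶ Hom(X, S₁) ⟶ ⋯ ⟶ Hom(X, S_{d+1})` is exact for every `X` in `M`. -/
structure IsLeftExactSeq (d : ℕ) (M : ObjectProperty (ModuleCat.{u} Λᵐᵒᵖ))
    (S : ComposableArrows (ModuleCat.{u} Λᵐᵒᵖ) (d + 1)) : Prop where
  mem : ∀ i : Fin (d + 1 + 1), M (S.obj i)
  isComplex : S.IsComplex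
  injective : ∀ X : ModuleCat.{u} Λᵐᵒᵖ, M X →
    Function.Injective (fun a : X ⟶ S.obj' 0 => a ≫ S.map' 0 1)
  exact : ∀ X : ModuleCat.{u} Λᵐᵒᵖ, M X → ∀ (i : ℕ) (_ : i + 2 ≤ d + 1),
    Function.Exact (fun a : X ⟶ S.obj' i => a ≫ S.map' i (i + 1))
      (fun a : X ⟶ S.obj' (i + 1) => a ≫ S.map' (i + 1) (i + 2))

/-- `X` is a right determiner of `g : A ⟶ B` in `M`, i.e. `g` is right `X`-determined in `M`:
all of `X`, `A`, `B` lie in `M`, and each `h : V ⟶ B` in `M` such that the image of `Hom(X, h)` is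
contained in the image of `Hom(X, g)` factors through `g`. -/
structure IsRightDeterminer (M : ObjectProperty (ModuleCat.{u} Λᵐᵒᵖ)) (X : ModuleCat.{u} Λᵐᵒᵖ)
    {A B : ModuleCat.{u} Λᵐᵒᵖ} (g : A ⟶ B) : Prop where
  mem : M X
  mem_source : M A
  mem_target : M B
  factors : ∀ (V : ModuleCat.{u} Λᵐᵒᵖ), M V → ∀ h : V ⟶ B,
    Set.range (fun a : X ⟶ V => a ≫ h) ⊆ Set.range (fun a : X ⟶ A => a ≫ g) →
      ∃ k : V ⟶ A, k ≫ g = h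

end Subcategories

/-! ### The duality `D = Hom_R(-, I)` -/

section Duality

/-- `S` is a complete set of representatives of the isomorphism classes of simple `R`-modules. -/
structure IsCompleteSetOfSimples (R : Type u) [CommRing R] {n : ℕ}
    (S : Fin n → ModuleCat.{u} R) : Prop where
  simple : ∀ i, IsSimpleModule R (S i)
  eq_of_iso : ∀ i j, Nonempty (S i ≃ₗ[R] S j) → i = j
  exists_iso : ∀ T : ModuleCat.{u} R, IsSimpleModule R T → ∃ i, Nonempty (T ≃ₗ[R] S i)

/-- `e : S → I` is an injective envelope: `I` is injective and `e` is an essential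
monomorphism. -/
structure IsInjectiveEnvelope {R : Type u} [CommRing R] {S I : Type u} [AddCommGroup S]
    [Module R S] [AddCommGroup I] [Module R I] (e : S →ₗ[R] I) : Prop where
  injective_module : Module.Injective R I
  injective : Function.Injective e
  essential : ∀ N : Submodule R I, N ⊓ LinearMap.range e = ⊥ → N = ⊥

variable {R Λ : Type u} [CommRing R] [Ring Λ] [Algebra R Λ]
variable (I : Type u) [AddCommGroup I] [Module R I]

variable (R) in
/-- The abelian group `Hom_R(X, I)` for a right `Λ`-module `X`. -/
def DualSpace (X : ModuleCat.{u} Λᵐᵒᵖ) : Type u := RestrictScalars R Λᵐᵒᵖ X →ₗ[R] I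

noncomputable instance (X : ModuleCat.{u} Λᵐᵒᵖ) : AddCommGroup (DualSpace R I X) :=
  inferInstanceAs (AddCommGroup (RestrictScalars R Λᵐᵒᵖ X →ₗ[R] I))

/-- The left action of `Λ` on `Hom_R(X, I)`, namely `(l • f) x = f (x l)`. -/
noncomputable instance (X : ModuleCat.{u} Λᵐᵒᵖ) : Module Λ (DualSpace R I X) where
  smul l f :=
    let f' : RestrictScalars R Λᵐᵒᵖ X →ₗ[R] I := f
    f'.comp (RestrictScalars.lsmul R Λᵐᵒᵖ X (MulOpposite.op l))
  one_smul f := by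
    change LinearMap.comp _ _ = _
    rw [MulOpposite.op_one, map_one]; rfl
  mul_smul a b f := by
    change LinearMap.comp _ _ = LinearMap.comp (LinearMap.comp _ _) _
    rw [MulOpposite.op_mul, map_mul]; rfl
  smul_zero a := LinearMap.zero_comp _
  smul_add a f g := LinearMap.add_comp _ _ _
  add_smul a b f := by
    change LinearMap.comp _ _ = LinearMap.comp _ _ + LinearMap.comp _ _
    rw [MulOpposite.op_add, map_add]; exact LinearMap.comp_add _ _ _
  zero_smul f := by
    change LinearMap.comp _ _ = _
    rw [MulOpposite.op_zero, map_zero]; exact LinearMap.comp_zero _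

/-- The value of a functional `f : X → I` at `x`. -/
def DualSpace.eval {X : ModuleCat.{u} Λᵐᵒᵖ} (f : DualSpace R I X) (x : X) : I :=
  (show RestrictScalars R Λᵐᵒᵖ X →ₗ[R] I from f) x

theorem DualSpace.smul_eval {X : ModuleCat.{u} Λᵐᵒᵖ} (l : Λ) (f : DualSpace R I X) (x : X) :
    DualSpace.eval I (l • f) x = DualSpace.eval I f (MulOpposite.op l • x) := rfl

variable (R) in
/-- The left `Λ`-module `D X = Hom_R(X, I)`, where `X` is a right `Λ`-module. -/
noncomputable def dual (X : ModuleCat.{u} Λᵐᵒᵖ) : ModuleCat.{u} Λ :=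
  ModuleCat.of Λ (DualSpace R I X)

end Duality

/-! ### The higher transpose -/

section Transpose

variable {Λ : Type u} [Ring Λ]

/-- The higher transpose `Tr_d Y = Tr Ω^{d-1} Y` of a left `Λ`-module `Y`, computed from a
resolution `⋯ ⟶ P_d ⟶ P_{d-1} ⟶ ⋯ ⟶ P_0 ⟶ Y` by projective left modules: since
`P_d ⟶ P_{d-1} ⟶ Ω^{d-1} Y ⟶ 0` is a projective presentation of the `(d-1)`-st syzygy, `Tr_d Y` is
the cokernel of `Hom_Λ(P_{d-1}, Λ) ⟶ Hom_Λ(P_d, Λ)`, a right `Λ`-module through the right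
multiplication on `Λ`.  Meaningful for `1 ≤ d` and degreewise finitely generated `P`; as an object
of the stable category it does not depend on `P`. -/
abbrev transpose (d : ℕ) {Y : ModuleCat.{u} Λ} (P : ProjectiveResolution Y) : Type u :=
  (P.complex.X d →ₗ[Λ] Λ) ⧸
    LinearMap.range (LinearMap.lcomp Λᵐᵒᵖ Λ (P.complex.d d (d - 1)).hom)

end Transpose

end HigherAR

/-! Since `Λ` lies in `M`, a left `d`-exact sequence is exact in `mod Λ`; cut it into short exact
sequences. For `V` in `M` the groups `Ext^j(V, M^i)` vanish for `1 ≤ j ≤ d - 1`, so the connecting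
maps leading from `Ext^1(V, Ker g)` up to `Ext^d(V, L)` are injective. Hence a map `h : V → N` with
image in `Im g` factors through `g` if and only if its class in `Ext^d(V, L)` vanishes
(`IsLeftExactSeq.exists_class`, `ExtInjective.exists_lift`).

Dualising the resolution `P` gives an injective coresolution `L → D P_0 → D P_1 → ⋯`, and `Hom(V, D
P_i)` is the `R`-dual of `V ⊗ P_i = Hom(P_i^*, V)`. A class in `Ext^d(V, L)` is thus given by a
functional on `Hom(P_d^*, V)`, and it vanishes exactly when the functional kills the kernel of
`Hom(P_d^*, V) → Hom(P_{d-1}^*, V)`. That kernel is `Hom(τ_d⁻ L, V)`, so a class vanishes once all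
its pullbacks along maps `τ_d⁻ L → V` do (`exists_lift_rdual`). The summand `Λ` of the determiner
only forces `Im h ⊆ Im g`, which is automatic when `g` is an epimorphism.

Membership of `τ_d⁻ L` in `M` uses the same duality: `Ext^k(V, L) = 0` for `1 ≤ k ≤ d - 1` makes
`Hom(P^*, V)` exact in these degrees. The case `V = D Λ` shows that `P_0^* → ⋯ → P_d^*` begins a
projective resolution of `τ_d⁻ L`; the general case then says that `Ext^k(τ_d⁻ L, V) = 0`
(`IsClusterTilting.transpose_mem`). -/

namespace HigherAR

/-! ### Minimal injective cogenerators and reflexivity -/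

section Cogenerator

variable {R : Type u} [CommRing R] {I : Type u} [AddCommGroup I] [Module R I]

/-- Linear maps into an injective module extend along arbitrary linear maps, as long as kernels
allow it. -/
theorem exists_extension (hI : Module.Injective R I) {A B : Type u} [AddCommGroup A] [Module R A]
    [AddCommGroup B] [Module R B] (α : A →ₗ[R] B) (φ : A →ₗ[R] I)
    (h : ∀ a, α a = 0 → φ a = 0) : ∃ ψ : B →ₗ[R] I, ∀ a, ψ (α a) = φ a := by
  obtain ⟨ψ, hψ⟩ := hI.out ((LinearMap.ker α).liftQ α le_rfl)
    (LinearMap.ker_eq_bot.1 (Submodule.ker_liftQ_eq_bot' _ _ rfl))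
    ((LinearMap.ker α).liftQ φ fun a ha => h a ha)
  exact ⟨ψ, fun a => hψ ((LinearMap.ker α).mkQ a)⟩

variable (R I) in
/-- An injective module that detects non-zero elements and is minimal with this property: the dual
of a simple module has length at most one. -/
structure IsMinimalCogenerator : Prop where
  injective_module : Module.Injective R I
  exists_ne_zero : ∀ {W : Type u} [AddCommGroup W] [Module R W] (w : W), w ≠ 0 →
    ∃ f : W →ₗ[R] I, f w ≠ 0
  length_le_one : ∀ {T : Type u} [AddCommGroup T] [Module R T] [IsSimpleModule R T],
    Module.length R (T →ₗ[R] I) ≤ 1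

/-- The cyclic module `R w` has a simple quotient `R ⧸ m`, which embeds in `I` through one of the `S
i`; injectivity of `I` extends the resulting map from `R w` to `W`. -/
theorem IsInjectiveEnvelope.exists_ne_zero {n : ℕ} {S : Fin n → ModuleCat.{u} R}
    (hS : IsCompleteSetOfSimples R S) {e : (∀ i, S i) →ₗ[R] I} (he : IsInjectiveEnvelope e)
    {W : Type u} [AddCommGroup W] [Module R W] (w : W) (hw : w ≠ 0) :
    ∃ f : W →ₗ[R] I, f w ≠ 0 := by
  let t : R →ₗ[R] W := LinearMap.toSpanSingleton R W w
  have hker : LinearMap.ker t ≠ ⊤ := fun h => hw <| by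
    have : (1 : R) ∈ LinearMap.ker t := h ▸ Submodule.mem_top
    simpa [t] using this
  obtain ⟨m, hm, hle⟩ := Ideal.exists_le_maximal (LinearMap.ker t) hker
  have : IsSimpleModule R (R ⧸ m) := isSimpleModule_iff_isCoatom.2 hm.out
  obtain ⟨i, ⟨c⟩⟩ := hS.exists_iso (ModuleCat.of R (R ⧸ m)) this
  let φ : R →ₗ[R] I := e ∘ₗ LinearMap.single R (fun i => S i) i ∘ₗ c.toLinearMap ∘ₗ m.mkQ
  have hφ : ∀ a, φ a = 0 ↔ a ∈ m := fun a => by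
    have h1 : φ a = e (Pi.single i (c (m.mkQ a))) := rfl
    rw [h1, map_eq_zero_iff e he.injective, Pi.single_eq_zero_iff]
    exact (LinearEquiv.map_eq_zero_iff c).trans (Submodule.Quotient.mk_eq_zero m)
  obtain ⟨ψ, hψ⟩ := exists_extension he.injective_module t φ
    fun a ha => (hφ a).2 (hle ha)
  refine ⟨ψ, fun h => ?_⟩
  have h1 := hψ 1
  rw [show t 1 = w by simp [t], h] at h1
  exact hm.ne_top ((Ideal.eq_top_iff_one m).2 ((hφ 1).1 h1.symm))

/-- Essentiality forces a non-zero map from the simple module `T` to land in the sum of the `S i`,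
and in a single summand, because these are pairwise non-isomorphic. Two non-zero maps hit the same
summand, and since `T` is cyclic over the commutative ring `R`, one is a scalar multiple of the
other. -/
theorem IsInjectiveEnvelope.length_le_one {n : ℕ} {S : Fin n → ModuleCat.{u} R}
    (hS : IsCompleteSetOfSimples R S) {e : (∀ i, S i) →ₗ[R] I} (he : IsInjectiveEnvelope e)
    {T : Type u} [AddCommGroup T] [Module R T] [IsSimpleModule R T] :
    Module.length R (T →ₗ[R] I) ≤ 1 := by
  have lift : ∀ f : T →ₗ[R] I, f ≠ 0 → ∃ i, ∃ c : T →ₗ[R] S i, Function.Bijective c ∧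
      ∀ t, f t = e (Pi.single i (c t)) := by
    intro f hf
    have hinj : Function.Injective f := (LinearMap.injective_or_eq_zero f).resolve_right hf
    have hsimple : IsSimpleModule R (LinearMap.range f) :=
      IsSimpleModule.congr (LinearEquiv.ofInjective f hinj).symm
    have hne : LinearMap.range f ⊓ LinearMap.range e ≠ ⊥ := fun h =>
      hf (LinearMap.range_eq_bot.1 (he.essential _ h))
    have hatom := isSimpleModule_iff_isAtom.1 hsimple
    have hle : LinearMap.range f ≤ LinearMap.range e :=
      inf_eq_left.1 ((hatom.le_iff.1 inf_le_left).resolve_left hne)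
    let e' := LinearEquiv.ofInjective e he.injective
    let f' : T →ₗ[R] (∀ i, S i) := e'.symm.toLinearMap ∘ₗ
      f.codRestrict (LinearMap.range e) fun t => hle ⟨t, rfl⟩
    have hf' : ∀ t, e (f' t) = f t := fun t =>
      congrArg Subtype.val (e'.apply_symm_apply ⟨f t, hle ⟨t, rfl⟩⟩)
    have hs : ∀ i, IsSimpleModule R (S i) := hS.simple
    have hex : ∃ i, (LinearMap.proj i ∘ₗ f' : T →ₗ[R] S i) ≠ 0 := by
      by_contra! h
      apply hf
      ext t
      rw [← hf' t, show f' t = 0 from funext fun i => LinearMap.congr_fun (h i) t]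
      simp
    obtain ⟨i, hi⟩ := hex
    have hbij := (LinearMap.bijective_or_eq_zero _).resolve_right hi
    refine ⟨i, LinearMap.proj i ∘ₗ f', hbij, fun t => ?_⟩
    rw [← hf' t]
    congr 1
    funext j
    by_cases hj : j = i
    · subst hj; simp
    · rw [Pi.single_eq_of_ne hj]
      rcases LinearMap.bijective_or_eq_zero (LinearMap.proj j ∘ₗ f' : T →ₗ[R] S j) with h | h
      · exact absurd (hS.eq_of_iso j i
          ⟨(LinearEquiv.ofBijective _ h).symm.trans (LinearEquiv.ofBijective _ hbij)⟩) hj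
      · exact LinearMap.congr_fun h t
  by_cases hsub : Subsingleton (T →ₗ[R] I)
  · simp
  rw [not_subsingleton_iff_nontrivial] at hsub
  refine (Module.length_eq_one_iff.2 ?_).le
  refine isSimpleModule_iff_toSpanSingleton_surjective.2 ⟨hsub, fun f hf g => ?_⟩
  obtain ⟨i, c, hc, hfc⟩ := lift f hf
  by_cases hg : g = 0
  · exact ⟨0, by simp [hg]⟩
  obtain ⟨j, c', hc', hgc⟩ := lift g hg
  obtain rfl : i = j := hS.eq_of_iso i j
    ⟨(LinearEquiv.ofBijective _ hc).symm.trans (LinearEquiv.ofBijective _ hc')⟩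
  have : Nontrivial T := IsSimpleModule.nontrivial R T
  obtain ⟨s, hs⟩ := exists_ne (0 : T)
  have hgen := IsSimpleModule.toSpanSingleton_surjective R hs
  obtain ⟨t, ht⟩ := hc.2 (c' s)
  obtain ⟨r, rfl⟩ := hgen t
  refine ⟨r, LinearMap.ext fun x => ?_⟩
  obtain ⟨a, rfl⟩ := hgen x
  have hrs : g s = r • f s := by
    rw [hgc, hfc, ← ht, LinearMap.toSpanSingleton_apply, map_smul, Pi.single_smul, map_smul]
  simp only [LinearMap.toSpanSingleton_apply, LinearMap.smul_apply, map_smul, hrs]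

theorem IsInjectiveEnvelope.isMinimalCogenerator {n : ℕ} {S : Fin n → ModuleCat.{u} R}
    (hS : IsCompleteSetOfSimples R S) {e : (∀ i, S i) →ₗ[R] I} (he : IsInjectiveEnvelope e) :
    IsMinimalCogenerator R I where
  injective_module := he.injective_module
  exists_ne_zero := he.exists_ne_zero hS
  length_le_one := he.length_le_one hS

namespace IsMinimalCogenerator

theorem exists_separating (hI : IsMinimalCogenerator R I) {W : Type u} [AddCommGroup W] [Module R W] (N : Submodule R W)
    (w : W) (hw : w ∉ N) : ∃ f : W →ₗ[R] I, (∀ x ∈ N, f x = 0) ∧ f w ≠ 0 := by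
  obtain ⟨f, hf⟩ := hI.exists_ne_zero (N.mkQ w) (by simpa using hw)
  exact ⟨f ∘ₗ N.mkQ, fun x hx => by simp [(Submodule.Quotient.mk_eq_zero N).2 hx], hf⟩

/-- Induction along a composition series: injectivity of `I` keeps each dualised short exact
sequence exact. The inequality alone suffices for reflexivity. -/
theorem length_dual_le (hI : IsMinimalCogenerator R I) {W : Type u} [AddCommGroup W] [Module R W] (hW : IsFiniteLength R W) :
    Module.length R (W →ₗ[R] I) ≤ Module.length R W := by
  induction hW with
  | of_subsingleton => simp
  | @of_simple_quotient W _ _ N _ _ ih =>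
    rw [Module.length_eq_add_of_exact N.subtype N.mkQ N.injective_subtype N.mkQ_surjective
      (LinearMap.exact_subtype_mkQ N), Module.length_eq_one R (W ⧸ N)]
    have hex : Function.Exact (LinearMap.lcomp R I N.mkQ) (LinearMap.lcomp R I N.subtype) := by
      intro f
      constructor
      · intro h
        have hle : N ≤ LinearMap.ker f := fun x hx => LinearMap.congr_fun h ⟨x, hx⟩
        exact ⟨N.liftQ f hle, N.liftQ_mkQ f hle⟩
      · rintro ⟨g, rfl⟩
        ext x
        have hx : N.mkQ x = 0 := (Submodule.Quotient.mk_eq_zero N).2 x.2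
        exact (congrArg g hx).trans (map_zero g)
    have hsurj : Function.Surjective (LinearMap.lcomp R I N.subtype) := fun f => by
      obtain ⟨g, hg⟩ := hI.injective_module.out N.subtype N.injective_subtype f
      exact ⟨g, LinearMap.ext hg⟩
    have hinj : Function.Injective (LinearMap.lcomp R I N.mkQ) := fun f g h =>
      LinearMap.cancel_right N.mkQ_surjective |>.1 h
    rw [Module.length_eq_add_of_exact _ _ hinj hsurj hex, add_comm]
    exact add_le_add ih hI.length_le_one

theorem isFiniteLength_dual (hI : IsMinimalCogenerator R I) {W : Type u} [AddCommGroup W] [Module R W]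
    (hW : IsFiniteLength R W) : IsFiniteLength R (W →ₗ[R] I) :=
  Module.length_ne_top_iff.1
    (ne_top_of_le_ne_top (Module.length_ne_top_iff.2 hW) (hI.length_dual_le hW))

theorem eval_injective (hI : IsMinimalCogenerator R I) {W : Type u} [AddCommGroup W] [Module R W] (w : W)
    (h : ∀ f : W →ₗ[R] I, f w = 0) : w = 0 := by
  by_contra hw
  obtain ⟨f, hf⟩ := hI.exists_ne_zero w hw
  exact hf (h f)

/-- Modules of finite length are reflexive. -/
theorem eval_surjective (hI : IsMinimalCogenerator R I) {W : Type u} [AddCommGroup W] [Module R W] (hW : IsFiniteLength R W)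
    (ψ : (W →ₗ[R] I) →ₗ[R] I) : ∃ w, ∀ f, ψ f = f w := by
  let ev : W →ₗ[R] ((W →ₗ[R] I) →ₗ[R] I) := LinearMap.flip LinearMap.id
  have hinj : Function.Injective ev := (injective_iff_map_eq_zero ev).2 fun w hw =>
    hI.eval_injective w fun f => LinearMap.congr_fun hw f
  -- The bidual is no longer than `W`, into which evaluation embeds `W`; additivity of length leaves
  -- no room for a cokernel.
  have hle : Module.length R ((W →ₗ[R] I) →ₗ[R] I) ≤ Module.length R W :=
    (hI.length_dual_le (hI.isFiniteLength_dual hW)).trans (hI.length_dual_le hW)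
  have hadd := Module.length_eq_add_of_exact ev (LinearMap.range ev).mkQ hinj
    (Submodule.mkQ_surjective _) (LinearMap.exact_map_mkQ_range ev)
  have hzero : Module.length R (((W →ₗ[R] I) →ₗ[R] I) ⧸ LinearMap.range ev) = 0 := by
    rw [hadd] at hle
    have := Module.length_ne_top_iff.2 hW
    exact nonpos_iff_eq_zero.1 ((ENat.add_le_add_iff_left this).1 (by simpa using hle))
  have hsub := Module.length_eq_zero_iff.1 hzero
  have htop : LinearMap.range ev = ⊤ := Submodule.Quotient.subsingleton_iff.1 hsub
  obtain ⟨w, hw⟩ := LinearMap.range_eq_top.1 htop ψ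
  exact ⟨w, fun f => (LinearMap.congr_fun hw f).symm⟩

end IsMinimalCogenerator

end Cogenerator

/-! ### Duals of finitely generated projective modules -/

section DualBasis

variable {Λ P : Type u} [Ring Λ] [AddCommGroup P] [Module Λ P]

/-- A finitely generated projective module has a finite dual basis. -/
theorem exists_dual_basis [Module.Finite Λ P] [Module.Projective Λ P] :
    ∃ (n : ℕ) (b : Fin n → P) (φ : Fin n → (P →ₗ[Λ] Λ)), ∀ p, ∑ j, φ j p • b j = p := by
  obtain ⟨n, f, hf⟩ := Module.Finite.exists_fin' Λ P
  obtain ⟨s, hs⟩ := Module.projective_lifting_property f LinearMap.id hf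
  refine ⟨n, fun j => f (Pi.single j 1), fun j => LinearMap.proj j ∘ₗ s, fun p => ?_⟩
  conv_rhs => rw [← LinearMap.id_apply (R := Λ) p, ← hs, LinearMap.comp_apply,
    pi_eq_sum_univ' (s p), map_sum]
  exact Finset.sum_congr rfl fun j _ => by
    rw [← map_smul]
    congr 1

/-- The `Λ`-dual of a finitely generated projective left module is a finitely generated right
module. -/
theorem finite_projective_dual [Module.Finite Λ P] [Module.Projective Λ P] :
    Module.Finite Λᵐᵒᵖ (P →ₗ[Λ] Λ) ∧ Module.Projective Λᵐᵒᵖ (P →ₗ[Λ] Λ) := by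
  obtain ⟨n, b, φ, hb⟩ := exists_dual_basis (Λ := Λ) (P := P)
  let s : (P →ₗ[Λ] Λ) →ₗ[Λᵐᵒᵖ] (Fin n → Λᵐᵒᵖ) :=
    { toFun := fun ψ j => MulOpposite.op (ψ (b j))
      map_add' := fun _ _ => rfl
      map_smul' := fun _ _ => rfl }
  let t : (Fin n → Λᵐᵒᵖ) →ₗ[Λᵐᵒᵖ] (P →ₗ[Λ] Λ) := Fintype.linearCombination Λᵐᵒᵖ φ
  have hts : t ∘ₗ s = LinearMap.id := by
    ext ψ p
    conv_rhs => rw [LinearMap.id_apply, ← hb p, map_sum]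
    simp [t, s, Fintype.linearCombination_apply]
  exact ⟨Module.Finite.of_surjective t fun ψ => ⟨s ψ, LinearMap.congr_fun hts ψ⟩,
    Module.Projective.of_split s t hts⟩

end DualBasis

/-! ### `Hom(V, D P)` as the `R`-dual of `Hom(P^*, V)` -/

section RDual

variable {R Λ : Type u} [CommRing R] [Ring Λ] [Algebra R Λ]
variable {I : Type u} [AddCommGroup I] [Module R I]
variable {P : Type u} [AddCommGroup P] [Module R P] [Module Λ P] [IsScalarTower R Λ P]
variable {Q : Type u} [AddCommGroup Q] [Module R Q] [Module Λ Q] [IsScalarTower R Λ Q]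
variable {V : Type u} [AddCommGroup V] [Module R V] [Module Λᵐᵒᵖ V] [IsScalarTower R Λᵐᵒᵖ V]

variable (R I P) in
/-- The dual `Hom_R(P, I)` of a left `Λ`-module, with its right `Λ`-action `(f l) p = f (l p)`. -/
abbrev RDual : Type u := P →ₗ[R] I

noncomputable instance : Module Λᵐᵒᵖ (RDual R I P) where
  smul l f := f ∘ₗ Algebra.lsmul R R P l.unop
  one_smul f := LinearMap.ext fun p => congrArg f (one_smul Λ p)
  mul_smul a b f := LinearMap.ext fun p => congrArg f (mul_smul b.unop a.unop p)
  smul_zero _ := rfl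
  smul_add _ _ _ := rfl
  add_smul a b f := LinearMap.ext fun p =>
    (congrArg f (add_smul a.unop b.unop p)).trans (map_add f _ _)
  zero_smul f := LinearMap.ext fun p => (congrArg f (zero_smul Λ p)).trans (map_zero f)

@[simp]
theorem rdual_smul_apply (l : Λᵐᵒᵖ) (f : RDual R I P) (p : P) : (l • f) p = f (l.unop • p) := rfl

instance : IsScalarTower R Λᵐᵒᵖ (RDual R I P) where
  smul_assoc r l f := LinearMap.ext fun p => by
    simp

/-- The transpose of a `Λ`-linear map between left modules. -/
noncomputable def rdualMap (δ : P →ₗ[Λ] Q) : RDual R I Q →ₗ[Λᵐᵒᵖ] RDual R I P where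
  toFun f := f ∘ₗ δ.restrictScalars R
  map_add' _ _ := rfl
  map_smul' l f := LinearMap.ext fun p => congrArg f (map_smul δ l.unop p).symm

@[simp]
theorem rdualMap_apply (δ : P →ₗ[Λ] Q) (f : RDual R I Q) (p : P) :
    rdualMap δ f p = f (δ p) := rfl

theorem linearMap_smul_of_tower {W : Type u} [AddCommGroup W] [Module R W] [Module Λᵐᵒᵖ W]
    [IsScalarTower R Λᵐᵒᵖ W] (f : V →ₗ[Λᵐᵒᵖ] W) (r : R) (v : V) : f (r • v) = r • f v :=
  LinearMap.map_smul_of_tower f r v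

/-- In tensor terms `Hom(A, D P) = Hom_R(A ⊗ P, I)`, which is exact in `A` because `P` is flat and
`I` is injective. A dual basis of `P` replaces the tensor product. -/
theorem injective_rdual (hI : Module.Injective R I) [Module.Finite Λ P] [Module.Projective Λ P] :
    Module.Injective Λᵐᵒᵖ (RDual R I P) where
  out := by
    intro A B _ _ _ _ α hα f
    let _ : Module R A := Module.compHom A (algebraMap R Λᵐᵒᵖ)
    let _ : Module R B := Module.compHom B (algebraMap R Λᵐᵒᵖ)
    have : IsScalarTower R Λᵐᵒᵖ A := IsScalarTower.of_algebraMap_smul fun _ _ => rfl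
    have : IsScalarTower R Λᵐᵒᵖ B := IsScalarTower.of_algebraMap_smul fun _ _ => rfl
    obtain ⟨n, b, φ, hb⟩ := exists_dual_basis (Λ := Λ) (P := P)
    have hex : ∀ j, ∃ G : B →ₗ[R] I, ∀ a, G (α a) = f a (b j) := fun j => by
      obtain ⟨G, hG⟩ := hI.out (α.restrictScalars R) hα
        (LinearMap.applyₗ (b j) ∘ₗ f.restrictScalars R)
      exact ⟨G, hG⟩
    choose G hG using hex
    -- Writing `p = ∑ φ j p • b j` reduces the extension to the functionals `a ↦ f a (b j)`, which
    -- extend to the `G j`.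
    let g : B →ₗ[Λᵐᵒᵖ] RDual R I P :=
      { toFun := fun y =>
          { toFun := fun p => ∑ j, G j (MulOpposite.op (φ j p) • y)
            map_add' := fun p q => by
              simp [add_smul, Finset.sum_add_distrib]
            map_smul' := fun r p => by
              simp [Finset.smul_sum, LinearMap.map_smul_of_tower] }
        map_add' := fun x y => LinearMap.ext fun p => by
          simp [Finset.sum_add_distrib]
        map_smul' := fun l y => LinearMap.ext fun p => by
          simp [mul_smul] }
    refine ⟨g, fun a => LinearMap.ext fun p => ?_⟩
    change ∑ j, G j (MulOpposite.op (φ j p) • α a) = f a p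
    conv_rhs => rw [← hb p, map_sum]
    refine Finset.sum_congr rfl fun j _ => ?_
    rw [← map_smul, hG, map_smul]
    rfl

/-- The map `P^* → V`, `φ ↦ v φ(p)`. -/
noncomputable def rankOne (v : V) (p : P) : (P →ₗ[Λ] Λ) →ₗ[Λᵐᵒᵖ] V where
  toFun φ := MulOpposite.op (φ p) • v
  map_add' φ ψ := by simp [add_smul]
  map_smul' l φ := by simp [← mul_smul]

@[simp]
theorem rankOne_apply (v : V) (p : P) (φ : P →ₗ[Λ] Λ) :
    rankOne v p φ = MulOpposite.op (φ p) • v := rfl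

/-- Precomposition with the `Λ`-dual of `δ`, on maps into `V`. -/
noncomputable def transposeMap (δ : P →ₗ[Λ] Q) :
    ((P →ₗ[Λ] Λ) →ₗ[Λᵐᵒᵖ] V) →ₗ[R] ((Q →ₗ[Λ] Λ) →ₗ[Λᵐᵒᵖ] V) where
  toFun u := u ∘ₗ LinearMap.lcomp Λᵐᵒᵖ Λ δ
  map_add' _ _ := rfl
  map_smul' _ _ := rfl

/-- A functional on `Hom(P^*, V)` (the tensor product `V ⊗ P`) gives a map `V → D P`. -/
noncomputable def ofFunctional (ψ : ((P →ₗ[Λ] Λ) →ₗ[Λᵐᵒᵖ] V) →ₗ[R] I) :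
    V →ₗ[Λᵐᵒᵖ] RDual R I P where
  toFun v :=
    { toFun := fun p => ψ (rankOne v p)
      map_add' := fun p q => by
        rw [← map_add]; congr 1; ext φ; simp [add_smul]
      map_smul' := fun r p => by
        rw [RingHom.id_apply, ← map_smul]; congr 1; ext φ
        simp [LinearMap.map_smul_of_tower] }
  map_add' v w := LinearMap.ext fun p => by
    change ψ _ = ψ _ + ψ _
    rw [← map_add]; congr 1; ext φ; simp
  map_smul' l v := LinearMap.ext fun p => by
    change ψ _ = ψ _
    congr 1; ext φ; simp [mul_smul]

@[simp]
theorem ofFunctional_apply (ψ : ((P →ₗ[Λ] Λ) →ₗ[Λᵐᵒᵖ] V) →ₗ[R] I) (v : V) (p : P) :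
    ofFunctional ψ v p = ψ (rankOne v p) := rfl

/-- Every map out of `P^*` is a sum of maps of rank one. -/
theorem exists_eq_sum_rankOne [Module.Finite Λ P] [Module.Projective Λ P]
    (u : (P →ₗ[Λ] Λ) →ₗ[Λᵐᵒᵖ] V) :
    ∃ (n : ℕ) (v : Fin n → V) (p : Fin n → P), u = ∑ j, rankOne (v j) (p j) := by
  obtain ⟨n, b, φ, hb⟩ := exists_dual_basis (Λ := Λ) (P := P)
  refine ⟨n, fun j => u (φ j), b, LinearMap.ext fun ψ => ?_⟩
  have hψ : ψ = ∑ j, MulOpposite.op (ψ (b j)) • φ j := by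
    ext p
    conv_lhs => rw [← hb p, map_sum]
    simp
  conv_lhs => rw [hψ, map_sum]
  simp

/-- Every map `V → D P` comes from a functional on `Hom(P^*, V)`. -/
theorem exists_functional [Module.Finite Λ P] [Module.Projective Λ P]
    (f : V →ₗ[Λᵐᵒᵖ] RDual R I P) :
    ∃ ψ : ((P →ₗ[Λ] Λ) →ₗ[Λᵐᵒᵖ] V) →ₗ[R] I, ∀ v p, ψ (rankOne v p) = f v p := by
  obtain ⟨n, b, φ, hb⟩ := exists_dual_basis (Λ := Λ) (P := P)
  -- Under `Hom(P^*, V) = V ⊗ P` the map `u` corresponds to `∑ u (φ j) ⊗ b j`, to which `f` is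
  -- applied.
  refine ⟨{ toFun := fun u => ∑ j, f (u (φ j)) (b j)
            map_add' := fun u w => by simp [Finset.sum_add_distrib]
            map_smul' := fun r u => by
              simp [Finset.smul_sum, linearMap_smul_of_tower f] }, fun v p => ?_⟩
  change ∑ j, f (MulOpposite.op (φ j p) • v) (b j) = f v p
  conv_rhs => rw [← hb p, map_sum]
  simp

end RDual

end HigherAR

universe v w

namespace HigherAR

/-! ### Dimension shifting with spliced extension classes -/

section Shift

open Abelian

variable {C : Type u} [Category.{v} C] [Abelian C] [HasExt.{w} C]

/-- Composition with `θ : Ext^i(K, L)` is injective on `Ext^j(V, K)` for `j ≥ 1`, `j + i ≤ N`. -/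
def ExtInjective (V : C) (N : ℕ) {K L : C} {i : ℕ} (θ : Ext K L i) : Prop :=
  ∀ (j m : ℕ) (h : j + i = m), 1 ≤ j → m ≤ N → ∀ x : Ext V K j, x.comp θ h = 0 → x = 0

/-- Composition with `θ : Ext^i(K, L)` is surjective from `Ext^j(V, K)` for `j ≥ 1`. -/
def ExtSurjective (V : C) {K L : C} {i : ℕ} (θ : Ext K L i) : Prop :=
  ∀ (j m : ℕ) (h : j + i = m), 1 ≤ j → ∀ y : Ext V L m, ∃ x : Ext V K j, x.comp θ h = y

theorem extInjective_iso (V : C) (N : ℕ) {K L : C} (e : K ≅ L) :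
    ExtInjective V N (Ext.mk₀ e.hom) := by
  rintro j _ rfl _ _ x hx
  have h : (x.comp (Ext.mk₀ e.hom) (add_zero j)).comp (Ext.mk₀ e.inv) (add_zero j) = 0 := by
    rw [hx, Ext.zero_comp]
  simpa using h

theorem extSurjective_iso (V : C) {K L : C} (e : K ≅ L) : ExtSurjective V (Ext.mk₀ e.hom) := by
  rintro j _ rfl _ y
  exact ⟨y.comp (Ext.mk₀ e.inv) (add_zero j), by simp⟩

variable {S : ShortComplex C}

/-- The connecting map out of `Ext^j(V, X₃)` has kernel coming from `Ext^j(V, X₂) = 0`. The bound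
`N` is there because a cluster-tilting subcategory provides this vanishing only in low degrees. -/
theorem ExtInjective.extClass_comp (hS : S.ShortExact) {V L : C} {N i i' : ℕ} {θ : Ext S.X₁ L i}
    (hθ : ExtInjective V N θ) (hi : 1 + i = i')
    (hV : ∀ j, 1 ≤ j → j + i' ≤ N → Subsingleton (Ext V S.X₂ j)) :
    ExtInjective V N (hS.extClass.comp θ hi) := by
  rintro j m h hj hm x hx
  rw [← Ext.comp_assoc x hS.extClass θ rfl hi (by lia)] at hx
  obtain ⟨y, rfl⟩ := Ext.covariant_sequence_exact₃ _ hS x rfl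
    (hθ (j + 1) m (by lia) (by lia) hm _ hx)
  have := hV j hj (by lia)
  rw [Subsingleton.elim y 0, Ext.zero_comp]

theorem ExtSurjective.extClass_comp (hS : S.ShortExact) {V L : C} {i i' : ℕ} {θ : Ext S.X₁ L i}
    (hθ : ExtSurjective V θ) (hi : 1 + i = i')
    (hV : ∀ j, 1 ≤ j → Subsingleton (Ext V S.X₂ j)) :
    ExtSurjective V (hS.extClass.comp θ hi) := by
  rintro j m h hj y
  obtain ⟨x, rfl⟩ := hθ (j + 1) m (by lia) (by lia) y
  have := hV (j + 1) (by lia)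
  obtain ⟨z, rfl⟩ := Ext.covariant_sequence_exact₁ _ hS x (Subsingleton.elim _ _) rfl
  exact ⟨z, (Ext.comp_assoc z hS.extClass θ rfl hi (by lia)).symm⟩

/-- A map to the end of a short exact sequence lifts as soon as its class in `Ext^{i+1}` is
zero. -/
theorem ExtInjective.exists_lift (hS : S.ShortExact) {V L : C} {N i : ℕ} {θ : Ext S.X₁ L i}
    (hθ : ExtInjective V N θ) (hi : 1 + i ≤ N) (h : V ⟶ S.X₃)
    (hh : (Ext.mk₀ h).comp (hS.extClass.comp θ rfl) (zero_add (1 + i)) = 0) :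
    ∃ k : V ⟶ S.X₂, k ≫ S.g = h := by
  rw [← Ext.comp_assoc (Ext.mk₀ h) hS.extClass θ (zero_add 1) rfl (by lia)] at hh
  obtain ⟨y, hy⟩ := Ext.covariant_sequence_exact₃ _ hS (Ext.mk₀ h) (zero_add 1)
    (hθ 1 (1 + i) rfl le_rfl hi _ hh)
  obtain ⟨k, rfl⟩ := Ext.mk₀_bijective _ _ |>.2 y
  refine ⟨k, (Ext.mk₀_bijective _ _).1 ?_⟩
  rw [← hy, Ext.mk₀_comp_mk₀]

theorem mk₀_comp_extClass_comp_eq_zero (hS : S.ShortExact) {V L : C} {i i' : ℕ} (θ : Ext S.X₁ L i) (hi : 1 + i = i')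
    (k : V ⟶ S.X₂) : (Ext.mk₀ (k ≫ S.g)).comp (hS.extClass.comp θ hi) (zero_add i') = 0 := by
  rw [← Ext.comp_assoc (Ext.mk₀ (k ≫ S.g)) hS.extClass θ (zero_add 1) hi (by lia),
    ← Ext.mk₀_comp_mk₀, Ext.comp_assoc_of_second_deg_zero, hS.comp_extClass, Ext.comp_zero,
    Ext.zero_comp]

/-- Classes in `Ext^{i+1}(V, L)` are pullbacks of the class of the sequence spliced with `θ`. -/
theorem ExtSurjective.exists_hom (hS : S.ShortExact) {V L : C} {i i' : ℕ} {θ : Ext S.X₁ L i}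
    (hθ : ExtSurjective V θ) (hi : 1 + i = i') (hV : Subsingleton (Ext V S.X₂ 1))
    (ξ : Ext V L i') :
    ∃ h : V ⟶ S.X₃, (Ext.mk₀ h).comp (hS.extClass.comp θ hi) (zero_add i') = ξ := by
  obtain ⟨x, rfl⟩ := hθ 1 i' hi le_rfl ξ
  obtain ⟨z, rfl⟩ := Ext.covariant_sequence_exact₁ _ hS x (Subsingleton.elim _ _) (zero_add 1)
  obtain ⟨h, rfl⟩ := Ext.mk₀_bijective _ _ |>.2 z
  exact ⟨h, (Ext.comp_assoc (Ext.mk₀ h) hS.extClass θ (zero_add 1) hi (by lia)).symm⟩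

theorem subsingleton_ext_one (hS : S.ShortExact) {V : C} (hP : Subsingleton (Ext S.X₂ V 1))
    (hlift : ∀ f : S.X₁ ⟶ V, ∃ g : S.X₂ ⟶ V, S.f ≫ g = f) : Subsingleton (Ext S.X₃ V 1) := by
  refine subsingleton_of_forall_eq 0 fun x => ?_
  obtain ⟨y, rfl⟩ := Ext.contravariant_sequence_exact₃ hS V x (Subsingleton.elim _ _) (add_zero 1)
  obtain ⟨f, rfl⟩ := Ext.mk₀_bijective _ _ |>.2 y
  obtain ⟨g, rfl⟩ := hlift f
  rw [← Ext.mk₀_comp_mk₀, ← Ext.comp_assoc_of_second_deg_zero, hS.extClass_comp, Ext.zero_comp]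

theorem subsingleton_ext_succ (hS : S.ShortExact) {V : C} {k : ℕ} (hP : Subsingleton (Ext S.X₂ V (k + 1)))
    (hK : Subsingleton (Ext S.X₁ V k)) : Subsingleton (Ext S.X₃ V (k + 1)) := by
  refine subsingleton_of_forall_eq 0 fun x => ?_
  obtain ⟨y, rfl⟩ := Ext.contravariant_sequence_exact₃ hS V x (Subsingleton.elim _ _)
    (add_comm 1 k)
  rw [Subsingleton.elim y 0, Ext.comp_zero]

end Shift

/-- If `Hom(-, D Λ)` turns `P₀^* → P₁^* → P₂^*` into an exact sequence, it was exact. -/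
theorem exists_comp_eq_of_rdual {R Λ : Type u} [CommRing R] [Ring Λ] [Algebra R Λ]
    {I : Type u} [AddCommGroup I] [Module R I] {P₀ P₁ P₂ : Type u} [AddCommGroup P₀] [Module Λ P₀]
    [AddCommGroup P₁] [Module Λ P₁] [AddCommGroup P₂] [Module Λ P₂] (hI : IsMinimalCogenerator R I)
    (δ₂ : P₂ →ₗ[Λ] P₁) (δ₁ : P₁ →ₗ[Λ] P₀)
    (hex : ∀ x : (P₁ →ₗ[Λ] Λ) →ₗ[Λᵐᵒᵖ] RDual R I Λ, x ∘ₗ LinearMap.lcomp Λᵐᵒᵖ Λ δ₁ = 0 →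
      ∃ w : (P₂ →ₗ[Λ] Λ) →ₗ[Λᵐᵒᵖ] RDual R I Λ, w ∘ₗ LinearMap.lcomp Λᵐᵒᵖ Λ δ₂ = x)
    (φ : P₁ →ₗ[Λ] Λ) (hφ : φ ∘ₗ δ₂ = 0) : ∃ χ : P₀ →ₗ[Λ] Λ, χ ∘ₗ δ₁ = φ := by
  by_contra hne
  obtain ⟨F, hF, hFφ⟩ := hI.exists_separating
    (LinearMap.range (LinearMap.lcomp R Λ δ₁)) φ hne
  -- This is the map corresponding to `F` under `Hom(X, D Λ) = Hom_R(X, I)`; evaluation at `1`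
  -- recovers `F`.
  let x : (P₁ →ₗ[Λ] Λ) →ₗ[Λᵐᵒᵖ] RDual R I Λ :=
    { toFun := fun χ =>
        { toFun := fun l => F (MulOpposite.op l • χ)
          map_add' := fun l m => by simp [add_smul]
          map_smul' := fun r l => by
            rw [RingHom.id_apply, ← map_smul]; congr 1; ext p; simp }
      map_add' := fun χ χ' => LinearMap.ext fun l => by simp
      map_smul' := fun a χ => LinearMap.ext fun l => by simp [mul_smul] }
  obtain ⟨w, hw⟩ := hex x (LinearMap.ext fun χ => LinearMap.ext fun l =>
    hF _ ⟨MulOpposite.op l • χ, rfl⟩)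
  have h1 : x φ = 0 := by
    rw [← hw, LinearMap.comp_apply, show LinearMap.lcomp Λᵐᵒᵖ Λ δ₂ φ = 0 from hφ, map_zero]
  refine hFφ ?_
  have h2 : F (MulOpposite.op (1 : Λ) • φ) = 0 := LinearMap.congr_fun h1 1
  rwa [MulOpposite.op_one, one_smul] at h2

/-! ### Exactness and lifting by duality -/

section Core

variable {R Λ : Type u} [CommRing R] [Ring Λ] [Algebra R Λ]
variable {I : Type u} [AddCommGroup I] [Module R I]
variable {P₀ : Type u} [AddCommGroup P₀] [Module R P₀] [Module Λ P₀] [IsScalarTower R Λ P₀]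
variable {P₁ : Type u} [AddCommGroup P₁] [Module R P₁] [Module Λ P₁] [IsScalarTower R Λ P₁]
variable {P₂ : Type u} [AddCommGroup P₂] [Module R P₂] [Module Λ P₂] [IsScalarTower R Λ P₂]
variable {V : Type u} [AddCommGroup V] [Module R V] [Module Λᵐᵒᵖ V] [IsScalarTower R Λᵐᵒᵖ V]

theorem rdualMap_exact (hI : Module.Injective R I) {δ₂ : P₂ →ₗ[Λ] P₁} {δ₁ : P₁ →ₗ[Λ] P₀}
    (h : Function.Exact δ₂ δ₁) :
    Function.Exact (rdualMap (R := R) (I := I) δ₁) (rdualMap (R := R) (I := I) δ₂) := by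
  intro f
  constructor
  · intro hf
    obtain ⟨g, hg⟩ := exists_extension hI (δ₁.restrictScalars R) f fun a ha => by
      obtain ⟨p, rfl⟩ := (h a).1 ha
      exact LinearMap.congr_fun hf p
    exact ⟨g, LinearMap.ext hg⟩
  · rintro ⟨g, rfl⟩
    ext p
    simp [h.apply_apply_eq_zero p]

/-- Exactness of `Hom(V, D P)` implies exactness of `Hom(P^*, V)`, that is, of `V ⊗ P`. -/
theorem exists_comp_lcomp_eq (hI : IsMinimalCogenerator R I)
    [Module.Finite Λ P₁] [Module.Projective Λ P₁] [Module.Finite Λ P₀] [Module.Projective Λ P₀]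
    (δ₂ : P₂ →ₗ[Λ] P₁) (δ₁ : P₁ →ₗ[Λ] P₀)
    (hex : ∀ f : V →ₗ[Λᵐᵒᵖ] RDual R I P₁, rdualMap δ₂ ∘ₗ f = 0 →
      ∃ b : V →ₗ[Λᵐᵒᵖ] RDual R I P₀, rdualMap δ₁ ∘ₗ b = f)
    (x : (P₁ →ₗ[Λ] Λ) →ₗ[Λᵐᵒᵖ] V) (hx : x ∘ₗ LinearMap.lcomp Λᵐᵒᵖ Λ δ₁ = 0) :
    ∃ w : (P₂ →ₗ[Λ] Λ) →ₗ[Λᵐᵒᵖ] V, w ∘ₗ LinearMap.lcomp Λᵐᵒᵖ Λ δ₂ = x := by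
  by_contra hne
  -- A functional `ψ` separating `x` from the image corresponds to a map `V → D P₁` killed by `D P₁
  -- → D P₂`. Its lift to `D P₀` writes `ψ` as a functional `β` of `x ∘ δ₁^*`, which is zero.
  obtain ⟨ψ, hψ, hψx⟩ := hI.exists_separating
    (LinearMap.range (transposeMap (R := R) (V := V) δ₂)) x hne
  obtain ⟨b, hb⟩ := hex (ofFunctional ψ)
    (LinearMap.ext fun v => LinearMap.ext fun p => hψ _ ⟨rankOne v p, rfl⟩)
  obtain ⟨β, hβ⟩ := exists_functional b
  obtain ⟨n, v, p, rfl⟩ := exists_eq_sum_rankOne x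
  refine hψx ?_
  have h1 : ∑ j, (rankOne (v j) (δ₁ (p j)) : (P₀ →ₗ[Λ] Λ) →ₗ[Λᵐᵒᵖ] V) = 0 := by
    rw [← hx]
    ext φ
    simp
  rw [map_sum, ← map_zero β, ← h1, map_sum]
  refine Finset.sum_congr rfl fun j _ => ?_
  rw [hβ]
  exact (LinearMap.congr_fun (LinearMap.congr_fun hb (v j)) (p j)).symm

/-- If `f : V → D P₁` becomes liftable along `D P₀ → D P₁` after precomposition with all maps from
the transpose `Coker(P₀^* → P₁^*)`, then it is liftable. -/
theorem exists_lift_rdual (hI : IsMinimalCogenerator R I)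
    [Module.Finite Λ P₁] [Module.Projective Λ P₁] [Module.Finite Λ P₀] [Module.Projective Λ P₀]
    (δ : P₁ →ₗ[Λ] P₀) (f : V →ₗ[Λᵐᵒᵖ] RDual R I P₁)
    (hf : ∀ a : ((P₁ →ₗ[Λ] Λ) ⧸ LinearMap.range (LinearMap.lcomp Λᵐᵒᵖ Λ δ)) →ₗ[Λᵐᵒᵖ] V,
      ∃ b : ((P₁ →ₗ[Λ] Λ) ⧸ LinearMap.range (LinearMap.lcomp Λᵐᵒᵖ Λ δ)) →ₗ[Λᵐᵒᵖ] RDual R I P₀,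
        rdualMap δ ∘ₗ b = f ∘ₗ a) :
    ∃ b : V →ₗ[Λᵐᵒᵖ] RDual R I P₀, rdualMap δ ∘ₗ b = f := by
  obtain ⟨ψ, hψ⟩ := exists_functional f
  -- A lift of `f` amounts to extending `ψ` along `Hom(P₁^*, V) → Hom(P₀^*, V)`, so `ψ` only has to
  -- kill the kernel. An element of the kernel factors through the transpose as a map `a`, to which
  -- the hypothesis applies.
  obtain ⟨β, hβ⟩ := exists_extension hI.injective_module (transposeMap (R := R) (V := V) δ) ψ <| by
    intro x hx
    let N := LinearMap.range (LinearMap.lcomp Λᵐᵒᵖ Λ δ)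
    have hN : N ≤ LinearMap.ker x := by
      rintro _ ⟨φ, rfl⟩
      exact LinearMap.congr_fun hx φ
    let a := N.liftQ x hN
    obtain ⟨b, hb⟩ := hf a
    obtain ⟨β, hβ⟩ := exists_functional b
    -- Expanding the quotient map itself, and not `x`, into rank-one maps yields a relation with
    -- values in the transpose, where `b` is defined.
    obtain ⟨n, v, p, hvp⟩ := exists_eq_sum_rankOne (V := (P₁ →ₗ[Λ] Λ) ⧸ N) N.mkQ
    have hx' : x = ∑ j, rankOne (a (v j)) (p j) := by
      have : x = a ∘ₗ N.mkQ := rfl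
      rw [this, hvp]
      ext φ
      simp
    have h1 : ∑ j, (rankOne (v j) (δ (p j)) : (P₀ →ₗ[Λ] Λ) →ₗ[Λᵐᵒᵖ] ((P₁ →ₗ[Λ] Λ) ⧸ N)) = 0 := by
      have : N.mkQ ∘ₗ LinearMap.lcomp Λᵐᵒᵖ Λ δ = 0 :=
        LinearMap.ext fun φ => (Submodule.Quotient.mk_eq_zero N).2 ⟨φ, rfl⟩
      rw [← this, hvp]
      ext φ
      simp
    rw [hx', map_sum, ← map_zero β, ← h1, map_sum]
    refine Finset.sum_congr rfl fun j _ => ?_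
    rw [hβ, hψ]
    exact (LinearMap.congr_fun (LinearMap.congr_fun hb (v j)) (p j)).symm
  refine ⟨ofFunctional β, LinearMap.ext fun v => LinearMap.ext fun p => ?_⟩
  rw [← hψ v p, ← hβ]
  rfl

end Core

/-! ### The start of the coresolution `L → D P₀ → D P₁` -/

section Coresolution

variable {R Λ : Type u} [CommRing R] [Ring Λ] [Algebra R Λ]
variable {I : Type u} [AddCommGroup I] [Module R I]
variable {P₀ : Type u} [AddCommGroup P₀] [Module R P₀] [Module Λ P₀] [IsScalarTower R Λ P₀]
variable {P₁ : Type u} [AddCommGroup P₁] [Module R P₁] [Module Λ P₁] [IsScalarTower R Λ P₁]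

variable {L : ModuleCat.{u} Λᵐᵒᵖ} [Module R L] [IsScalarTower R Λᵐᵒᵖ L]

/-- `D L` consists of the `R`-linear maps from `L` to `I`. -/
noncomputable def dualSpaceEquiv : DualSpace R I L ≃ (L →ₗ[R] I) where
  toFun f :=
    { toFun := DualSpace.eval I f
      map_add' := LinearMap.map_add (show RestrictScalars R Λᵐᵒᵖ L →ₗ[R] I from f)
      map_smul' := fun r x => by
        rw [← algebraMap_smul Λᵐᵒᵖ r x]
        exact LinearMap.map_smul (show RestrictScalars R Λᵐᵒᵖ L →ₗ[R] I from f) r x }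
  invFun g := show RestrictScalars R Λᵐᵒᵖ L →ₗ[R] I from
    { toFun := g
      map_add' := LinearMap.map_add g
      map_smul' := fun r x =>
        (congrArg g (algebraMap_smul Λᵐᵒᵖ r (show L from x))).trans (LinearMap.map_smul g r x) }
  left_inv _ := rfl
  right_inv _ := rfl

/-- A map `P₀ → D L` gives a map `L → D P₀`. -/
noncomputable def coaugmentation (ε : P₀ →ₗ[Λ] DualSpace R I L) :
    L →ₗ[Λᵐᵒᵖ] RDual R I P₀ where
  toFun l :=
    { toFun := fun p => DualSpace.eval I (ε p) l
      map_add' := fun p q => by rw [map_add]; rfl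
      map_smul' := fun r p => by
        rw [← algebraMap_smul Λ r p, map_smul, DualSpace.smul_eval]
        refine Eq.trans ?_ (LinearMap.map_smul (dualSpaceEquiv (ε p)) r l)
        rw [← algebraMap_smul Λᵐᵒᵖ r l]
        rfl }
  map_add' l m := LinearMap.ext fun p => LinearMap.map_add (dualSpaceEquiv (ε p)) l m
  map_smul' a l := LinearMap.ext fun p => by
    change DualSpace.eval I (ε p) (a • l) = DualSpace.eval I (ε (a.unop • p)) l
    rw [map_smul, DualSpace.smul_eval, MulOpposite.op_unop]

theorem coaugmentation_injective (hI : IsMinimalCogenerator R I)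
    {ε : P₀ →ₗ[Λ] DualSpace R I L} (hε : Function.Surjective ε) :
    Function.Injective (coaugmentation ε) := by
  refine (injective_iff_map_eq_zero _).2 fun l hl => hI.eval_injective l fun f => ?_
  obtain ⟨p, hp⟩ := hε (dualSpaceEquiv.symm f)
  have := LinearMap.congr_fun hl p
  rw [← dualSpaceEquiv.apply_symm_apply f, ← hp]
  exact this

theorem coaugmentation_exact (hI : IsMinimalCogenerator R I) (hL : IsFiniteLength R L)
    {ε : P₀ →ₗ[Λ] DualSpace R I L} {δ : P₁ →ₗ[Λ] P₀} (h : Function.Exact δ ε) :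
    Function.Exact (coaugmentation ε) (rdualMap (R := R) (I := I) δ) := by
  intro f
  constructor
  · intro hf
    let ε' : P₀ →ₗ[R] (L →ₗ[R] I) := ((coaugmentation ε).restrictScalars R).flip
    -- A functional on `P₀` that kills the image of `δ` descends to `D L`; by reflexivity it is
    -- evaluation at an element of `L`.
    obtain ⟨ψ, hψ⟩ := exists_extension hI.injective_module ε' f fun p hp => by
      have hp' : ε p = 0 := dualSpaceEquiv.injective (hp.trans rfl)
      obtain ⟨q, rfl⟩ := (h p).1 hp'
      exact LinearMap.congr_fun hf q
    obtain ⟨l, hl⟩ := hI.eval_surjective hL ψ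
    exact ⟨l, LinearMap.ext fun p => ((hψ p).symm.trans (hl (ε' p))).symm⟩
  · rintro ⟨l, rfl⟩
    ext p
    change DualSpace.eval I (ε (δ p)) l = 0
    rw [h.apply_apply_eq_zero p]
    rfl

end Coresolution

/-! ### Ext from injective coresolutions and projective resolutions -/

section Sequences

variable {A : Type u} [Ring A]

/-- The short complex `ker f → X → ker g` attached to an exact sequence `X → Y → Z`. -/
@[simps]
noncomputable def kerSequence {X Y Z : ModuleCat.{u} A} (f : X ⟶ Y) (g : Y ⟶ Z)
    (h : Function.Exact f.hom g.hom) : ShortComplex (ModuleCat.{u} A) where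
  X₁ := ModuleCat.of A (LinearMap.ker f.hom)
  X₂ := X
  X₃ := ModuleCat.of A (LinearMap.ker g.hom)
  f := ModuleCat.ofHom (LinearMap.ker f.hom).subtype
  g := ModuleCat.ofHom (f.hom.codRestrict (LinearMap.ker g.hom) h.apply_apply_eq_zero)
  zero := by
    ext x
    exact x.2

theorem kerSequence_shortExact {X Y Z : ModuleCat.{u} A} (f : X ⟶ Y) (g : Y ⟶ Z)
    (h : Function.Exact f.hom g.hom) : (kerSequence f g h).ShortExact := by
  refine ModuleCat.shortComplex_shortExact _ (fun x => ?_) (Submodule.injective_subtype _) ?_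
  · constructor
    · intro hx
      exact ⟨⟨x, congrArg Subtype.val hx⟩, rfl⟩
    · rintro ⟨y, rfl⟩
      exact Subtype.ext y.2
  · rintro ⟨y, hy⟩
    obtain ⟨x, rfl⟩ := (h y).1 hy
    exact ⟨x, rfl⟩

theorem exists_lift_iff_kerSequence {V X Y Z : ModuleCat.{u} A} (f : X ⟶ Y) (g : Y ⟶ Z)
    (h : Function.Exact f.hom g.hom) (k : V ⟶ X) (l : V ⟶ (kerSequence f g h).X₃) :
    k ≫ (kerSequence f g h).g = l ↔
      k ≫ f = l ≫ ModuleCat.ofHom (LinearMap.ker g.hom).subtype := by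
  constructor
  · rintro rfl
    rfl
  · intro hk
    ext v
    exact Subtype.ext (ConcreteCategory.congr_hom hk v)

/-- A map annihilated by `g` as a map to the kernel of `g`. -/
noncomputable def toKer {V Y Z : ModuleCat.{u} A} (g : Y ⟶ Z) (l : V ⟶ Y) (hl : l ≫ g = 0) :
    V ⟶ ModuleCat.of A (LinearMap.ker g.hom) :=
  ModuleCat.ofHom (l.hom.codRestrict (LinearMap.ker g.hom) (ConcreteCategory.congr_hom hl))

/-- The kernel of `g` is isomorphic to the source of an injection with image the kernel of `g`. -/
noncomputable def kerIso {L Y Z : ModuleCat.{u} A} (f : L ⟶ Y) (g : Y ⟶ Z)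
    (hf : Function.Injective f.hom) (h : Function.Exact f.hom g.hom) :
    ModuleCat.of A (LinearMap.ker g.hom) ≅ L :=
  (LinearEquiv.ofBijective (f.hom.codRestrict (LinearMap.ker g.hom) h.apply_apply_eq_zero)
    ⟨fun _ _ hxy => hf (congrArg Subtype.val hxy), fun ⟨y, hy⟩ => by
      obtain ⟨x, rfl⟩ := (h y).1 hy
      exact ⟨x, rfl⟩⟩).toModuleIso.symm

variable {J : ℕ → ModuleCat.{u} A} {d : ∀ i, J i ⟶ J (i + 1)}

/-- Splicing the coresolution up to the `i`-th cosyzygy gives `θ`. Every `Ext^j(V, J i)` with `j ≥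
1` vanishes, so each shift is bijective in positive degrees and no bound on the degree is needed. -/
theorem exists_class_of_injectives (hex : ∀ i, Function.Exact (d i).hom (d (i + 1)).hom)
    (hJ : ∀ i, Injective (J i)) {L : ModuleCat.{u} A}
    (e : ModuleCat.of A (LinearMap.ker (d 0).hom) ≅ L) (i : ℕ) :
    ∃ θ : Abelian.Ext (ModuleCat.of A (LinearMap.ker (d i).hom)) L i, ∀ V : ModuleCat.{u} A,
      (∀ N, ExtInjective V N θ) ∧ ExtSurjective V θ := by
  induction i with
  | zero => exact ⟨Abelian.Ext.mk₀ e.hom, fun V =>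
      ⟨fun N => extInjective_iso V N e, extSurjective_iso V e⟩⟩
  | succ i ih =>
    obtain ⟨θ, hθ⟩ := ih
    have hS := kerSequence_shortExact (d i) (d (i + 1)) (hex i)
    have hV : ∀ (V : ModuleCat.{u} A) (j : ℕ), 1 ≤ j → Subsingleton (Abelian.Ext V (J i) j) := by
      intro V j hj
      obtain ⟨j, rfl⟩ := Nat.exists_eq_add_of_le' hj
      have := hJ i
      exact Abelian.Ext.subsingleton_of_injective V (J i) j
    exact ⟨hS.extClass.comp θ (add_comm 1 i), fun V =>
      ⟨fun N => ((hθ V).1 N).extClass_comp hS _ fun j hj _ => hV V j hj,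
        (hθ V).2.extClass_comp hS _ (hV V)⟩⟩

/-- In an injective coresolution of `L`, cocycles with values in degree `i + 1` are coboundaries if
`Ext^{i+1}(V, L)` vanishes. -/
theorem exists_lift_of_subsingleton_ext
    (hex : ∀ i, Function.Exact (d i).hom (d (i + 1)).hom)
    (hJ : ∀ i, Injective (J i)) {L : ModuleCat.{u} A}
    (e : ModuleCat.of A (LinearMap.ker (d 0).hom) ≅ L) (i : ℕ) {V : ModuleCat.{u} A}
    (hV : Subsingleton (Abelian.Ext V L (i + 1))) (f : V ⟶ J (i + 1))
    (hf : f ≫ d (i + 1) = 0) : ∃ b : V ⟶ J i, b ≫ d i = f := by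
  obtain ⟨θ, hθ⟩ := exists_class_of_injectives hex hJ e i
  rw [add_comm] at hV
  obtain ⟨k, hk⟩ := ((hθ V).1 (1 + i)).exists_lift
    (kerSequence_shortExact (d i) (d (i + 1)) (hex i)) le_rfl (toKer (d (i + 1)) f hf)
    (Subsingleton.elim _ _)
  exact ⟨k, (exists_lift_iff_kerSequence _ _ _ _ _).1 hk⟩

/-- If lifting along `J^i → J^{i+1}` can be tested after precomposition with maps from `X`, then
so can the vanishing of classes in `Ext^{i+1}(-, L)`. -/
theorem ext_eq_zero_of_forall_comp
    (hex : ∀ i, Function.Exact (d i).hom (d (i + 1)).hom)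
    (hJ : ∀ i, Injective (J i)) {L : ModuleCat.{u} A}
    (e : ModuleCat.of A (LinearMap.ker (d 0).hom) ≅ L) (i : ℕ) {V X : ModuleCat.{u} A}
    (hX : ∀ f : V ⟶ J (i + 1), (∀ a : X ⟶ V, ∃ b : X ⟶ J i, b ≫ d i = a ≫ f) →
      ∃ b : V ⟶ J i, b ≫ d i = f) (ξ : Abelian.Ext V L (1 + i))
    (hξ : ∀ a : X ⟶ V, (Abelian.Ext.mk₀ a).comp ξ (zero_add (1 + i)) = 0) : ξ = 0 := by
  obtain ⟨θ, hθ⟩ := exists_class_of_injectives hex hJ e i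
  have hS := kerSequence_shortExact (d i) (d (i + 1)) (hex i)
  have := hJ i
  -- Surjectivity of the shift represents `ξ` by a cocycle `h`; injectivity turns the vanishing of
  -- each pullback of `ξ` into a lift.
  obtain ⟨h, rfl⟩ := (hθ V).2.exists_hom hS rfl
    (Abelian.Ext.subsingleton_of_injective V (J i) 0) ξ
  obtain ⟨b, hb⟩ := hX (h ≫ ModuleCat.ofHom (LinearMap.ker (d (i + 1)).hom).subtype) fun a => by
    have ha := hξ a
    rw [Abelian.Ext.mk₀_comp_mk₀_assoc] at ha
    obtain ⟨b, hb⟩ := ((hθ X).1 (1 + i)).exists_lift hS le_rfl (a ≫ h) ha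
    exact ⟨b, (exists_lift_iff_kerSequence _ _ _ _ _).1 hb⟩
  rw [← (exists_lift_iff_kerSequence _ _ (hex i) b h).2 hb]
  exact mk₀_comp_extClass_comp_eq_zero hS θ rfl b

/-- Vanishing of `Ext^k(X, V)` computed from the beginning of a projective resolution
`Q_{k+1} → Q_k → ⋯ → Q_0 → X → 0`. -/
theorem subsingleton_ext_of_projectives (V : ModuleCat.{u} A) (k : ℕ) :
    ∀ (Q : ℕ → ModuleCat.{u} A) (δ : ∀ i, Q (i + 1) ⟶ Q i) (_ : ∀ i, Projective (Q i))
      (_ : ∀ i ≤ k, Function.Exact (δ (i + 1)).hom (δ i).hom)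
      (_ : ∀ f : Q (k + 1) ⟶ V, δ (k + 1) ≫ f = 0 → ∃ g : Q k ⟶ V, δ k ≫ g = f),
      Subsingleton (Abelian.Ext
        (ModuleCat.of A (Q 0 ⧸ LinearMap.range (δ 0).hom)) V (k + 1)) := by
  induction k with
  | zero =>
    intro Q δ hQ hex hV
    have := hQ 0
    have h0 : Function.Exact (LinearMap.range (δ 0).hom).subtype
        (LinearMap.range (δ 0).hom).mkQ := LinearMap.exact_subtype_mkQ _
    let S : ShortComplex (ModuleCat.{u} A) := ModuleCat.shortComplexOfCompEqZero _ _
      h0.linearMap_comp_eq_zero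
    have hS : S.ShortExact := ModuleCat.shortComplex_shortExact S h0
      (Submodule.injective_subtype _) (Submodule.mkQ_surjective _)
    refine subsingleton_ext_one hS (Abelian.Ext.subsingleton_of_projective (Q 0) V 0) fun f => ?_
    obtain ⟨g, hg⟩ := hV (ModuleCat.ofHom (δ 0).hom.rangeRestrict ≫ f) (by
      ext x
      have : (δ 0).hom.rangeRestrict ((δ 1).hom x) = 0 :=
        Subtype.ext ((hex 0 le_rfl).apply_apply_eq_zero x)
      exact (congrArg f.hom this).trans (map_zero f.hom))
    refine ⟨g, ModuleCat.hom_ext (LinearMap.ext ?_)⟩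
    rintro ⟨_, x, rfl⟩
    exact ConcreteCategory.congr_hom hg x
  | succ k ih =>
    intro Q δ hQ hex hV
    have := hQ 0
    have ih' := ih (fun i => Q (i + 1)) (fun i => δ (i + 1)) (fun i => hQ (i + 1))
      (fun i hi => hex (i + 1) (by lia)) hV
    have hle : LinearMap.range (δ 1).hom ≤ LinearMap.ker (δ 0).hom := by
      rintro _ ⟨x, rfl⟩
      exact (hex 0 (by lia)).apply_apply_eq_zero x
    -- The cokernel of `δ 1` is the first syzygy: exactness at `Q 1` embeds it in `Q 0`, and the
    -- degree drops by one.
    let ι : (Q 1 ⧸ LinearMap.range (δ 1).hom) →ₗ[A] Q 0 :=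
      (LinearMap.range (δ 1).hom).liftQ (δ 0).hom hle
    have hι : Function.Injective ι := by
      refine LinearMap.ker_eq_bot.1 (Submodule.ker_liftQ_eq_bot _ _ _ fun x hx => ?_)
      exact (hex 0 (by lia) x).1 hx
    have h0 : Function.Exact ι (LinearMap.range (δ 0).hom).mkQ := by
      rw [LinearMap.exact_iff, Submodule.ker_mkQ, Submodule.range_liftQ]
    let S : ShortComplex (ModuleCat.{u} A) := ModuleCat.shortComplexOfCompEqZero _ _
      h0.linearMap_comp_eq_zero
    have hS : S.ShortExact := ModuleCat.shortComplex_shortExact S h0 hι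
      (Submodule.mkQ_surjective _)
    exact subsingleton_ext_succ hS (Abelian.Ext.subsingleton_of_projective (Q 0) V (k + 1)) ih'

end Sequences

/-! ### Left `d`-exact sequences in a cluster-tilting subcategory -/

section ClusterTilting

variable {Λ : Type u} [Ring Λ]

/-- The map `Λ → X` of right modules with `1 ↦ x`. -/
def regularHom {X : ModuleCat.{u} Λᵐᵒᵖ} (x : X) : ModuleCat.of Λᵐᵒᵖ Λ ⟶ X :=
  ModuleCat.ofHom
    { toFun := fun l => MulOpposite.op l • x
      map_add' := fun a b => by rw [MulOpposite.op_add, add_smul]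
      map_smul' := fun a l => by
        rw [RingHom.id_apply, ← mul_smul]
        rfl }

theorem regularHom_one {X : ModuleCat.{u} Λᵐᵒᵖ} (x : X) : (regularHom x).hom (1 : Λ) = x :=
  one_smul Λᵐᵒᵖ x

theorem regularHom_comp {X Y : ModuleCat.{u} Λᵐᵒᵖ} (x : X) (f : X ⟶ Y) :
    regularHom x ≫ f = regularHom (f.hom x) :=
  ModuleCat.hom_ext (LinearMap.ext fun l => map_smul f.hom (MulOpposite.op l) x)

theorem regularHom_zero (X : ModuleCat.{u} Λᵐᵒᵖ) : regularHom (0 : X) = 0 :=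
  ModuleCat.hom_ext (LinearMap.ext fun l => smul_zero (MulOpposite.op (l : Λ)))

/-- `Λ` is free of rank one as a right module. -/
def regularEquiv : Λᵐᵒᵖ ≃ₗ[Λᵐᵒᵖ] Λ where
  toFun := MulOpposite.unop
  invFun := MulOpposite.op
  map_add' _ _ := rfl
  map_smul' _ _ := rfl
  left_inv _ := rfl
  right_inv _ := rfl

theorem finite_regular : Module.Finite Λᵐᵒᵖ Λ := Module.Finite.equiv regularEquiv

theorem projective_regular : Module.Projective Λᵐᵒᵖ Λ := Module.Projective.of_equiv regularEquiv

variable {d : ℕ} {M : ObjectProperty (ModuleCat.{u} Λᵐᵒᵖ)}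

theorem IsClusterTilting.regular_mem (hM : IsClusterTilting d M) : M (ModuleCat.of Λᵐᵒᵖ Λ) := by
  refine (hM.mem_iff_left _).2 ⟨finite_regular, fun Y _ k hk _ => ?_⟩
  obtain ⟨k, rfl⟩ := Nat.exists_eq_add_of_le' hk
  have := projective_regular (Λ := Λ)
  have : Projective (ModuleCat.of Λᵐᵒᵖ Λ) := ModuleCat.projective_of_categoryTheory_projective _
  exact Abelian.Ext.subsingleton_of_projective _ Y k

theorem IsClusterTilting.prod_mem (hM : IsClusterTilting d M) {X Y : Type u} [AddCommGroup X]
    [Module Λᵐᵒᵖ X] [AddCommGroup Y] [Module Λᵐᵒᵖ Y] (hX : M (ModuleCat.of Λᵐᵒᵖ X))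
    (hY : M (ModuleCat.of Λᵐᵒᵖ Y)) : M (ModuleCat.of Λᵐᵒᵖ (X × Y)) := by
  have hX' := (hM.mem_iff_left _).1 hX
  have hY' := (hM.mem_iff_left _).1 hY
  refine (hM.mem_iff_left _).2 ⟨?_, fun Z hZ k hk hkd => ?_⟩
  · have : Module.Finite Λᵐᵒᵖ X := hX'.1
    have : Module.Finite Λᵐᵒᵖ Y := hY'.1
    exact (inferInstance : Module.Finite Λᵐᵒᵖ (X × Y))
  · have h1 := hX'.2 Z hZ k hk hkd
    have h2 := hY'.2 Z hZ k hk hkd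
    refine subsingleton_of_forall_eq 0 fun x => ?_
    have hid : 𝟙 (ModuleCat.of Λᵐᵒᵖ (X × Y)) =
        ModuleCat.ofHom (LinearMap.fst Λᵐᵒᵖ X Y) ≫ ModuleCat.ofHom (LinearMap.inl Λᵐᵒᵖ X Y) +
        ModuleCat.ofHom (LinearMap.snd Λᵐᵒᵖ X Y) ≫ ModuleCat.ofHom (LinearMap.inr Λᵐᵒᵖ X Y) := by
      ext p <;> simp
    rw [← Abelian.Ext.mk₀_id_comp x, hid, Abelian.Ext.mk₀_add, Abelian.Ext.add_comp,
      ← Abelian.Ext.mk₀_comp_mk₀_assoc, ← Abelian.Ext.mk₀_comp_mk₀_assoc,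
      Subsingleton.elim ((Abelian.Ext.mk₀ (ModuleCat.ofHom (LinearMap.inl Λᵐᵒᵖ X Y))).comp x _) 0,
      Subsingleton.elim ((Abelian.Ext.mk₀ (ModuleCat.ofHom (LinearMap.inr Λᵐᵒᵖ X Y))).comp x _) 0,
      Abelian.Ext.comp_zero, Abelian.Ext.comp_zero, add_zero]

/-- Testing against `Λ`, which lies in `M`, gives honest exactness, since maps `Λ → X` are elements
of `X`. -/
theorem IsLeftExactSeq.injective_hom (hM : IsClusterTilting d M)
    {E : ComposableArrows (ModuleCat.{u} Λᵐᵒᵖ) (d + 1)} (hE : IsLeftExactSeq d M E) :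
    Function.Injective (E.map' 0 1).hom := by
  refine (injective_iff_map_eq_zero _).2 fun x hx => ?_
  have h : regularHom x = regularHom 0 := hE.injective _ hM.regular_mem <| by
    change regularHom x ≫ _ = regularHom 0 ≫ _
    rw [regularHom_comp, regularHom_comp, hx, map_zero]
  rw [← regularHom_one x, h, regularHom_one]

theorem IsLeftExactSeq.exact_hom (hM : IsClusterTilting d M)
    {E : ComposableArrows (ModuleCat.{u} Λᵐᵒᵖ) (d + 1)} (hE : IsLeftExactSeq d M E)
    (i : ℕ) (hi : i + 2 ≤ d + 1) :
    Function.Exact (E.map' i (i + 1)).hom (E.map' (i + 1) (i + 2)).hom := by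
  intro x
  constructor
  · intro hx
    obtain ⟨a, ha⟩ := (hE.exact _ hM.regular_mem i hi (regularHom x)).1 (by
      change regularHom x ≫ _ = 0
      rw [regularHom_comp, hx, regularHom_zero])
    exact ⟨a.hom (1 : Λ), (ConcreteCategory.congr_hom ha (1 : Λ)).trans (regularHom_one x)⟩
  · rintro ⟨y, rfl⟩
    exact ConcreteCategory.congr_hom (hE.isComplex.zero i) y

/-- The iterated extension class of a left `d`-exact sequence. -/
theorem IsLeftExactSeq.exists_class (hM : IsClusterTilting d M)
    {E : ComposableArrows (ModuleCat.{u} Λᵐᵒᵖ) (d + 1)} (hE : IsLeftExactSeq d M E)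
    (i : ℕ) : ∀ hi : i + 1 ≤ d,
    ∃ θ : Abelian.Ext (ModuleCat.of Λᵐᵒᵖ (LinearMap.ker (E.map' (i + 1) (i + 2)).hom))
      (E.obj' 0) i, ∀ V, M V → ExtInjective V d θ := by
  induction i with
  | zero =>
    intro hi
    let e := kerIso (E.map' 0 1) (E.map' 1 2) (hE.injective_hom hM) (hE.exact_hom hM 0 (by lia))
    exact ⟨Abelian.Ext.mk₀ e.hom, fun V _ => extInjective_iso V d e⟩
  | succ i ih =>
    intro hi
    obtain ⟨θ, hθ⟩ := ih (by lia)
    have hS := kerSequence_shortExact (E.map' (i + 1) (i + 2)) (E.map' (i + 2) (i + 3))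
      (hE.exact_hom hM (i + 1) (by lia))
    exact ⟨hS.extClass.comp θ (add_comm 1 i), fun V hV =>
      -- Here `j + (i + 1) ≤ d` gives `j ≤ d - 1`, exactly the range in which `Ext^j` vanishes on
      -- `M`.
      (hθ V hV).extClass_comp hS _ fun j hj hjd =>
        ((hM.mem_iff_left V).1 hV).2 _ (hE.mem ⟨i + 1, by lia⟩) j hj (by lia)⟩

end ClusterTilting

/-! ### The higher transpose of `D L`: membership and detection of Ext -/

section Resolution

variable {R Λ : Type u} [CommRing R] [Ring Λ] [Algebra R Λ]
variable {I : Type u} [AddCommGroup I] [Module R I] {L : ModuleCat.{u} Λᵐᵒᵖ}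

/-- Modules over an `R`-algebra as `R`-modules. -/
@[reducible]
def restrictModule {B : Type u} [Ring B] [Algebra R B] (X : ModuleCat.{u} B) : Module R X :=
  Module.compHom X (algebraMap R B)

attribute [local instance] restrictModule

theorem isScalarTower_restrictModule {B : Type u} [Ring B] [Algebra R B] (X : ModuleCat.{u} B) :
    IsScalarTower R B X :=
  IsScalarTower.of_algebraMap_smul fun _ _ => rfl

attribute [local instance] isScalarTower_restrictModule

variable (P : ProjectiveResolution (dual R I L))

/-- The terms `D P_i` of the coresolution of `L`. -/
noncomputable abbrev coresObj (i : ℕ) : ModuleCat.{u} Λᵐᵒᵖ :=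
  ModuleCat.of Λᵐᵒᵖ (RDual R I (P.complex.X i))

/-- The differentials `D P_i → D P_{i+1}` of the coresolution of `L`. -/
noncomputable abbrev coresD (i : ℕ) : coresObj P i ⟶ coresObj P (i + 1) :=
  ModuleCat.ofHom (rdualMap (P.complex.d (i + 1) i).hom)

theorem resolution_module_projective (i : ℕ) : Module.Projective Λ (P.complex.X i) :=
  have := P.projective i
  ModuleCat.projective_of_module_projective _

theorem coresD_exact (hI : IsMinimalCogenerator R I) (i : ℕ) :
    Function.Exact (coresD P i).hom (coresD P (i + 1)).hom :=
  rdualMap_exact hI.injective_module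
    ((ShortComplex.ShortExact.moduleCat_exact_iff_function_exact _).1 (P.exact_succ i))

theorem coresObj_injective (hI : IsMinimalCogenerator R I)
    (hP : ∀ i : ℕ, Module.Finite Λ (P.complex.X i)) (i : ℕ) : Injective (coresObj P i) := by
  have := hP i
  have := resolution_module_projective P i
  have := injective_rdual (Λ := Λ) (P := P.complex.X i) hI.injective_module
  exact Module.injective_object_of_injective_module _ _

theorem nonempty_ker_coresD_iso (hI : IsMinimalCogenerator R I) (hL : IsFiniteLength R L) :
    Nonempty (ModuleCat.of Λᵐᵒᵖ (LinearMap.ker (coresD P 0).hom) ≅ L) := by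
  let ε : P.complex.X 0 →ₗ[Λ] DualSpace R I L := (P.π.f 0).hom
  have hε : Function.Surjective ε := (ModuleCat.epi_iff_surjective (P.π.f 0)).1 inferInstance
  have hex : Function.Exact (P.complex.d 1 0).hom ε :=
    (ShortComplex.ShortExact.moduleCat_exact_iff_function_exact _).1 P.exact₀
  exact ⟨kerIso (ModuleCat.ofHom (coaugmentation ε)) (coresD P 0)
    (coaugmentation_injective hI hε) (coaugmentation_exact hI hL hex)⟩

/-- Vanishing of `Ext^{b+1}(V, L)` implies exactness of `Hom(P^*, V)`. -/
theorem exists_comp_lcomp_resolution (hI : IsMinimalCogenerator R I) (hL : IsFiniteLength R L)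
    (hP : ∀ i : ℕ, Module.Finite Λ (P.complex.X i)) {V : ModuleCat.{u} Λᵐᵒᵖ} (b : ℕ)
    (hV : Subsingleton (Abelian.Ext V L (b + 1)))
    (x : (P.complex.X (b + 1) →ₗ[Λ] Λ) →ₗ[Λᵐᵒᵖ] V)
    (hx : x ∘ₗ LinearMap.lcomp Λᵐᵒᵖ Λ (P.complex.d (b + 1) b).hom = 0) :
    ∃ w : (P.complex.X (b + 2) →ₗ[Λ] Λ) →ₗ[Λᵐᵒᵖ] V,
      w ∘ₗ LinearMap.lcomp Λᵐᵒᵖ Λ (P.complex.d (b + 2) (b + 1)).hom = x := by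
  have h0 := hP b
  have h1 := hP (b + 1)
  have h0' := resolution_module_projective P b
  have h1' := resolution_module_projective P (b + 1)
  obtain ⟨e⟩ := nonempty_ker_coresD_iso P hI hL
  refine exists_comp_lcomp_eq hI _ _ (fun f hf => ?_) x hx
  obtain ⟨c, hc⟩ := exists_lift_of_subsingleton_ext (coresD_exact P hI)
    (coresObj_injective P hI hP) e b hV (ModuleCat.ofHom f)
    (ModuleCat.hom_ext hf)
  exact ⟨c.hom, congrArg ModuleCat.Hom.hom hc⟩

/-- This is the part of the higher Auslander–Reiten formula that is needed: maps from `τ_{i+1}⁻ L`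
detect `Ext^{i+1}(-, L)`. -/
theorem ext_eq_zero_of_forall_transpose (hI : IsMinimalCogenerator R I) (hL : IsFiniteLength R L)
    (hP : ∀ i : ℕ, Module.Finite Λ (P.complex.X i)) {V : ModuleCat.{u} Λᵐᵒᵖ} (i : ℕ)
    (ξ : Abelian.Ext V L (1 + i))
    (hξ : ∀ a : ModuleCat.of Λᵐᵒᵖ (transpose (i + 1) P) ⟶ V,
      (Abelian.Ext.mk₀ a).comp ξ (zero_add (1 + i)) = 0) : ξ = 0 := by
  have h0 := hP i
  have h1 := hP (i + 1)
  have h0' := resolution_module_projective P i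
  have h1' := resolution_module_projective P (i + 1)
  obtain ⟨e⟩ := nonempty_ker_coresD_iso P hI hL
  refine ext_eq_zero_of_forall_comp (coresD_exact P hI) (coresObj_injective P hI hP) e i
    (fun f hf => ?_) ξ hξ
  obtain ⟨c, hc⟩ := exists_lift_rdual hI (P.complex.d (i + 1) i).hom f.hom fun a => by
    obtain ⟨b, hb⟩ := hf (ModuleCat.ofHom a)
    exact ⟨b.hom, congrArg ModuleCat.Hom.hom hb⟩
  exact ⟨ModuleCat.ofHom c, ModuleCat.hom_ext hc⟩

theorem isFiniteLength_of_finite [IsArtinianRing R] [Module.Finite R Λ] (X : ModuleCat.{u} Λᵐᵒᵖ)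
    (hX : fgMod Λ X) : IsFiniteLength R X := by
  have : Module.Finite Λᵐᵒᵖ X := hX
  have : Module.Finite R Λᵐᵒᵖ := Module.Finite.equiv (MulOpposite.opLinearEquiv R)
  have : Module.Finite R X := Module.Finite.trans Λᵐᵒᵖ X
  exact isFiniteLength_iff_isNoetherian_isArtinian.2 ⟨inferInstance, inferInstance⟩

variable {d : ℕ} {M : ObjectProperty (ModuleCat.{u} Λᵐᵒᵖ)}

theorem IsClusterTilting.rdual_mem [IsArtinianRing R] [Module.Finite R Λ]
    (hI : IsMinimalCogenerator R I) (hM : IsClusterTilting d M) :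
    M (ModuleCat.of Λᵐᵒᵖ (RDual R I Λ)) := by
  refine (hM.mem_iff_right _).2 ⟨?_, fun X _ k hk _ => ?_⟩
  · have : Module.Finite R (RDual R I Λ) := by
      have := (isFiniteLength_iff_isNoetherian_isArtinian.1 (hI.isFiniteLength_dual (W := Λ)
        (isFiniteLength_iff_isNoetherian_isArtinian.2 ⟨inferInstance, inferInstance⟩))).1
      exact inferInstance
    exact Module.Finite.of_restrictScalars_finite R Λᵐᵒᵖ (RDual R I Λ)
  · obtain ⟨k, rfl⟩ := Nat.exists_eq_add_of_le' hk
    have := injective_rdual (Λ := Λ) (P := Λ) hI.injective_module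
    have : Injective (ModuleCat.of Λᵐᵒᵖ (RDual R I Λ)) :=
      Module.injective_object_of_injective_module _ _
    exact Abelian.Ext.subsingleton_of_injective X _ k

/-- The complex `P^*` is exact where `Ext(D Λ, L)` vanishes. -/
theorem lcomp_resolution_exact (hI : IsMinimalCogenerator R I) (hL : IsFiniteLength R L)
    (hP : ∀ i : ℕ, Module.Finite Λ (P.complex.X i)) (b : ℕ)
    (hV : Subsingleton (Abelian.Ext (ModuleCat.of Λᵐᵒᵖ (RDual R I Λ)) L (b + 1))) :
    Function.Exact (LinearMap.lcomp Λᵐᵒᵖ Λ (P.complex.d (b + 1) b).hom)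
      (LinearMap.lcomp Λᵐᵒᵖ Λ (P.complex.d (b + 2) (b + 1)).hom) := by
  intro φ
  constructor
  · exact exists_comp_eq_of_rdual hI _ _
      (exists_comp_lcomp_resolution P hI hL hP b hV) φ
  · rintro ⟨χ, rfl⟩
    ext p
    have h : (P.complex.d (b + 1) b).hom ((P.complex.d (b + 2) (b + 1)).hom p) = 0 :=
      ConcreteCategory.congr_hom (P.complex.d_comp_d (b + 2) (b + 1) b) p
    exact (congrArg χ h).trans (map_zero χ)

/-- The vanishing of `Ext^k(D Λ, L)` makes `P_0^* → ⋯ → P_d^*` exact in the middle, and the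
vanishing of `Ext^k(V, L)` keeps it exact after `Hom(-, V)`. -/
theorem IsClusterTilting.transpose_mem [IsArtinianRing R] [Module.Finite R Λ]
    (hI : IsMinimalCogenerator R I) (hM : IsClusterTilting d M) (hL : M L)
    (hP : ∀ i : ℕ, Module.Finite Λ (P.complex.X i)) :
    M (ModuleCat.of Λᵐᵒᵖ (transpose d P)) := by
  have hfg := isFiniteLength_of_finite (R := R) L ((hM.mem_iff_left L).1 hL).1
  have hext : ∀ V, M V → ∀ b, b + 2 ≤ d → Subsingleton (Abelian.Ext V L (b + 1)) :=
    fun V hV b hb => ((hM.mem_iff_left V).1 hV).2 L hL _ (by lia) (by lia)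
  have hdual : ∀ i, Module.Finite Λᵐᵒᵖ (P.complex.X i →ₗ[Λ] Λ) ∧
      Module.Projective Λᵐᵒᵖ (P.complex.X i →ₗ[Λ] Λ) := fun i =>
    have := hP i
    have := resolution_module_projective P i
    finite_projective_dual
  refine (hM.mem_iff_left _).2 ⟨?_, fun V hV k hk hkd => ?_⟩
  · have := (hdual d).1
    exact (inferInstance : Module.Finite Λᵐᵒᵖ (transpose d P))
  obtain ⟨k, rfl⟩ := Nat.exists_eq_add_of_le' hk
  -- The dual complex is read backwards from `P_d^*`. Truncated subtraction repeats `P_0^*` beyond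
  -- index `d`, which is harmless: exactness is only used where `i + 2 ≤ d`.
  let Q : ℕ → ModuleCat.{u} Λᵐᵒᵖ := fun i => ModuleCat.of Λᵐᵒᵖ (P.complex.X (d - i) →ₗ[Λ] Λ)
  let δ : ∀ i, Q (i + 1) ⟶ Q i := fun i =>
    ModuleCat.ofHom (LinearMap.lcomp Λᵐᵒᵖ Λ (P.complex.d (d - i) (d - (i + 1))).hom)
  refine subsingleton_ext_of_projectives V k Q δ (fun i => ?_) (fun i hi => ?_) (fun f hf => ?_)
  · have := (hdual (d - i)).2
    exact ModuleCat.projective_of_categoryTheory_projective _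
  · have key : ∀ b a c, a = b + 1 → c = b + 2 → b + 2 ≤ d →
        Function.Exact (LinearMap.lcomp Λᵐᵒᵖ Λ (P.complex.d a b).hom)
          (LinearMap.lcomp Λᵐᵒᵖ Λ (P.complex.d c a).hom) := by
      rintro b _ _ rfl rfl hb
      exact lcomp_resolution_exact P hI hfg hP b (hext _ (hM.rdual_mem hI) b hb)
    exact key (d - (i + 1 + 1)) (d - (i + 1)) (d - i) (by lia) (by lia) (by lia)
  · have key : ∀ b a c, a = b + 1 → c = b + 2 → b + 2 ≤ d →
        ∀ x : (P.complex.X a →ₗ[Λ] Λ) →ₗ[Λᵐᵒᵖ] V,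
          x ∘ₗ LinearMap.lcomp Λᵐᵒᵖ Λ (P.complex.d a b).hom = 0 →
          ∃ w : (P.complex.X c →ₗ[Λ] Λ) →ₗ[Λᵐᵒᵖ] V,
            w ∘ₗ LinearMap.lcomp Λᵐᵒᵖ Λ (P.complex.d c a).hom = x := by
      rintro b _ _ rfl rfl hb
      exact exists_comp_lcomp_resolution P hI hfg hP b (hext V hV b hb)
    obtain ⟨w, hw⟩ := key (d - (k + 1 + 1)) (d - (k + 1)) (d - k) (by lia) (by lia) (by lia)
      f.hom (congrArg ModuleCat.Hom.hom hf)
    exact ⟨ModuleCat.ofHom w, ModuleCat.hom_ext hw⟩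

/-- A map `h` whose image is contained in that of `g` factors through `g` if it does so after
precomposition with all maps from the transpose. -/
theorem IsLeftExactSeq.exists_factor [IsArtinianRing R] [Module.Finite R Λ]
    (hI : IsMinimalCogenerator R I) (hM : IsClusterTilting (d + 1) M)
    {E : ComposableArrows (ModuleCat.{u} Λᵐᵒᵖ) (d + 1 + 1)} (hE : IsLeftExactSeq (d + 1) M E)
    (P : ProjectiveResolution (dual R I (E.obj' 0)))
    (hP : ∀ i : ℕ, Module.Finite Λ (P.complex.X i)) {V : ModuleCat.{u} Λᵐᵒᵖ} (hV : M V)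
    (h : V ⟶ E.obj' (d + 1 + 1))
    (hrange : LinearMap.range h.hom ≤ LinearMap.range (E.map' (d + 1) (d + 1 + 1)).hom)
    (ha : ∀ a : ModuleCat.of Λᵐᵒᵖ (transpose (d + 1) P) ⟶ V,
      ∃ b : ModuleCat.of Λᵐᵒᵖ (transpose (d + 1) P) ⟶ E.obj' (d + 1),
        b ≫ E.map' (d + 1) (d + 1 + 1) = a ≫ h) :
    ∃ k : V ⟶ E.obj' (d + 1), k ≫ E.map' (d + 1) (d + 1 + 1) = h := by
  obtain ⟨θ, hθ⟩ := hE.exists_class hM d le_rfl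
  have hL : M (E.obj' 0) := hE.mem 0
  let g := E.map' (d + 1) (d + 1 + 1)
  let q := ModuleCat.ofHom (LinearMap.range g.hom).mkQ
  have hgq : Function.Exact g.hom q.hom := LinearMap.exact_map_mkQ_range g.hom
  have hS := kerSequence_shortExact g q hgq
  have hhq : h ≫ q = 0 := ModuleCat.hom_ext <| LinearMap.ext fun v =>
    (Submodule.Quotient.mk_eq_zero _).2 (hrange ⟨v, rfl⟩)
  let l : V ⟶ (kerSequence g q hgq).X₃ := toKer q h hhq
  -- The obstruction to lifting `l : V → Im g` is a class in `Ext^{d+1}(V, L)`. By `ha` its pullback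
  -- along each `a` lifts, hence vanishes.
  obtain ⟨k, hk⟩ := (hθ V hV).exists_lift hS (add_comm 1 d).le l <| by
    refine ext_eq_zero_of_forall_transpose P hI
      (isFiniteLength_of_finite _ ((hM.mem_iff_left _).1 hL).1) hP d _ fun a => ?_
    obtain ⟨b, hb⟩ := ha a
    rw [Abelian.Ext.mk₀_comp_mk₀_assoc,
      ← (exists_lift_iff_kerSequence g q hgq b (a ≫ l)).2 hb]
    exact mk₀_comp_extClass_comp_eq_zero hS θ rfl b
  exact ⟨k, (exists_lift_iff_kerSequence g q hgq k _).1 hk⟩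

end Resolution

end HigherAR

/-! ### The determiner theorem -/

theorem mainTheorem3
    (d : ℕ) (hd : 1 ≤ d)
    (R : Type u) [CommRing R] [IsArtinianRing R]
    (Λ : Type u) [Ring Λ] [Algebra R Λ] [Module.Finite R Λ]
    -- the injective `R`-module `I` that defines the duality `D = Hom_R(-, I)`
    {n : ℕ} (S : Fin n → ModuleCat.{u} R) (hS : HigherAR.IsCompleteSetOfSimples R S)
    (I : Type u) [AddCommGroup I] [Module R I]
    (e : (∀ i, S i) →ₗ[R] I) (he : HigherAR.IsInjectiveEnvelope e)
    (M : ObjectProperty (ModuleCat.{u} Λᵐᵒᵖ)) (hM : HigherAR.IsClusterTilting d M)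
    -- the left `d`-exact sequence `L = E₀ ⟶ E₁ ⟶ ⋯ ⟶ E_d ⟶ E_{d+1} = N`
    (E : ComposableArrows (ModuleCat.{u} Λᵐᵒᵖ) (d + 1)) (hE : HigherAR.IsLeftExactSeq d M E)
    -- any resolution of `D L` by finitely generated projectives, computing `τ_d⁻ L = Tr_d D L`
    (P : ProjectiveResolution (HigherAR.dual R I (E.obj' 0)))
    (hP : ∀ i : ℕ, Module.Finite Λ (P.complex.X i)) :
    HigherAR.IsRightDeterminer M (ModuleCat.of Λᵐᵒᵖ (Λ × HigherAR.transpose d P))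
        (E.map' d (d + 1)) ∧
      (Function.Surjective (E.map' d (d + 1)).hom →
        HigherAR.IsRightDeterminer M (ModuleCat.of Λᵐᵒᵖ (HigherAR.transpose d P))
          (E.map' d (d + 1))) := by
  obtain ⟨d, rfl⟩ := Nat.exists_eq_add_of_le' hd
  have hI := he.isMinimalCogenerator hS
  have hT := hM.transpose_mem P hI (hE.mem 0) hP
  refine ⟨⟨hM.prod_mem hM.regular_mem hT, hE.mem _, hE.mem _, fun V hV h hh => ?_⟩,
    fun hsurj => ⟨hT, hE.mem _, hE.mem _, fun V hV h hh => ?_⟩⟩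
  · refine hE.exists_factor hI hM P hP hV h ?_ fun a => ?_
    · rintro _ ⟨v, rfl⟩
      -- An element `v` is a map `Λ → V`, so testing on the summand `Λ` puts `h v` into the image of
      -- `g`.
      obtain ⟨b, hb⟩ := hh ⟨ModuleCat.ofHom (LinearMap.fst Λᵐᵒᵖ Λ (HigherAR.transpose (d + 1) P)) ≫
        HigherAR.regularHom v, rfl⟩
      refine ⟨b.hom (1, 0), (ConcreteCategory.congr_hom hb (1, 0)).trans ?_⟩
      exact congrArg h.hom (HigherAR.regularHom_one v)
    · obtain ⟨b, hb⟩ := hh ⟨ModuleCat.ofHom (LinearMap.snd Λᵐᵒᵖ Λ (HigherAR.transpose (d + 1) P)) ≫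
        a, rfl⟩
      refine ⟨ModuleCat.ofHom (LinearMap.inr Λᵐᵒᵖ Λ (HigherAR.transpose (d + 1) P)) ≫ b, ?_⟩
      exact ModuleCat.hom_ext <| LinearMap.ext fun x => ConcreteCategory.congr_hom hb
        ((0, x) : Λ × HigherAR.transpose (d + 1) P)
  · refine hE.exists_factor hI hM P hP hV h ?_ fun a => hh ⟨a, rfl⟩
    rw [LinearMap.range_eq_top.2 hsurj]
    exact le_top
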